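/- **Notation.** Let $d\ge 1$ be an integer, $\gamma\ge 1$ and $\alpha>0$ real, and $\mathscr S_\alpha=\{z\in\mathbb C:|\operatorname{Im}z|<\alpha\}$. Let $H_0=-\Delta$ in $L^2(\mathbb R^d)$ with domain $H^2(\mathbb R^d)$. A function $Q:\mathbb R^d\to\mathbb C$ is identified with the operator of multiplication by $Q$ in $L^2(\mathbb R^d)$ with domain $\{u\in L^2: Qu\in L^2\}$. A measurable $V:\mathbb R^d\to\mathbb C$ is called *dilation analytic on $\mathscr S_\alpha$* if a) $V\in L^{\gamma+d/2}(\mathbb R^d;\mathbb C)$; b) $V$ is $H_0$-compact, that is, $\mathcal D(V)\supset H^2(\mathbb R^d)$ and $V(H_0+1)^{-1}$ is a compact operator on $L^2(\mathbb R^d)$; c) the map $\theta\mapsto V_\theta$, $V_\theta(x):=V(e^{\theta}x)$, $\theta\in\mathbb R$, has an analytic continuation to $\mathscr S_\alpha$ with values in $L^{\gamma+d/2}(\mathbb R^d;\mathbb C)$, again denoted by $V_\theta$; d) the map $\theta\mapsto V_\theta(H_0+1)^{-1}$, $\theta\in\mathbb R$, extends to an analytic function on $\mathscr S_\alpha$ with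 values in the bounded operators on $L^2(\mathbb R^d)$. For $\theta\in\mathscr S_\alpha$ put $H(\theta):=e^{-2\theta}H_0+V_\theta$. For an operator $T$ in $L^2(\mathbb R^d)$, the discrete spectrum $\sigma_{\rm d}(T)$ is the set of all eigenvalues $\lambda$ of $T$ that are isolated points of the spectrum $\sigma(T)$ and have finite algebraic multiplicity $m_\lambda:=\sup_{k\in\mathbb N}\dim\ker[(T-\lambda)^k]$, and $\sigma_{\rm ess}(T):=\sigma(T)\setminus\sigma_{\rm d}(T)$ is the essential spectrum. **Proposition.** If $V$ is dilation analytic on $\mathscr S_\alpha$, then for every $\theta\in\mathscr S_\alpha$ $$\sigma_{\rm ess}(H(\theta))=e^{-2\theta}[0,\infty)=\{e^{-2\theta}x:x\in[0,\infty)\},$$ and $\sigma(H(\theta))\setminus e^{-2\theta}[0,\infty)=\sigma_{\rm d}(H(\theta))$, that is, off this half-line the spectrum of $H(\theta)$ consists of isolated eigenvalues of finite algebraic multiplicity. -/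

import Mathlib

open MeasureTheory Complex Set
open scoped ENNReal SchwartzMap Laplacian Topology

noncomputable section

namespace DilationAnalytic

/-- Euclidean space of dimension `d`. -/
abbrev Rd (d : ℕ) : Type := EuclideanSpace ℝ (Fin d)

/-- The Hilbert space of complex-valued square integrable functions (classes). -/
abbrev L2 (d : ℕ) : Type := Lp ℂ 2 (volume : Measure (Rd d))

/-! ### The free Schrödinger operator -/

theorem toTempered_injective (d : ℕ) {u v : L2 d}
    (h : (u : 𝓢'(Rd d, ℂ)) = (v : 𝓢'(Rd d, ℂ))) : u = v := by
  have hk := Lp.ker_toTemperedDistributionCLM_eq_bot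
    (E := Rd d) (F := ℂ) (μ := volume) (p := 2)
  exact LinearMap.ker_eq_bot.mp hk h

/-- The Sobolev space of order two, as a subspace of the square integrable functions. -/
def sobolevTwo (d : ℕ) : Submodule ℂ (L2 d) where
  carrier := {u | TemperedDistribution.MemSobolev 2 2 (u : 𝓢'(Rd d, ℂ))}
  add_mem' {u v} hu hv := by
    have h := hu.add hv
    rw [mem_ofPred_eq, ← Lp.toTemperedDistributionCLM_apply, map_add]
    exact h
  zero_mem' := by
    have h := TemperedDistribution.memSobolev_fun_zero (Rd d) ℂ 2 2
    rw [mem_ofPred_eq, ← Lp.toTemperedDistributionCLM_apply, map_zero]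
    exact h
  smul_mem' c u hu := by
    have h := hu.smul c
    rw [mem_ofPred_eq, ← Lp.toTemperedDistributionCLM_apply, map_smul]
    exact h

theorem exists_neg_laplacian (d : ℕ) (u : sobolevTwo d) :
    ∃ v : L2 d, (v : 𝓢'(Rd d, ℂ)) = -Δ ((u : L2 d) : 𝓢'(Rd d, ℂ)) := by
  have hu : TemperedDistribution.MemSobolev 2 2 ((u : L2 d) : 𝓢'(Rd d, ℂ)) := u.2
  have h := hu.laplacian.neg
  rw [sub_self, TemperedDistribution.memSobolev_zero_iff] at h
  obtain ⟨v, hv⟩ := h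
  exact ⟨v, hv.symm⟩

/-- The distributional `-Δ u` of a function `u` in the Sobolev space of order two. -/
def negLaplacian (d : ℕ) (u : sobolevTwo d) : L2 d := (exists_neg_laplacian d u).choose

theorem negLaplacian_spec (d : ℕ) (u : sobolevTwo d) :
    (negLaplacian d u : 𝓢'(Rd d, ℂ)) = -Δ ((u : L2 d) : 𝓢'(Rd d, ℂ)) :=
  (exists_neg_laplacian d u).choose_spec

/-- The operator `-Δ` whose domain is the Sobolev space of order two. -/
def freeOp (d : ℕ) : L2 d →ₗ.[ℂ] L2 d where
  domain := sobolevTwo d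
  toFun :=
    { toFun := negLaplacian d
      map_add' := fun u v => by
        apply toTempered_injective
        have hu := negLaplacian_spec d u
        have hv := negLaplacian_spec d v
        have huv := negLaplacian_spec d (u + v)
        simp only [← Lp.toTemperedDistributionCLM_apply, Submodule.coe_add, map_add,
          ← TemperedDistribution.laplacianCLM_apply] at hu hv huv ⊢
        rw [hu, hv, huv, neg_add]
      map_smul' := fun c u => by
        apply toTempered_injective
        have hu := negLaplacian_spec d u
        have hcu := negLaplacian_spec d (c • u)
        simp only [← Lp.toTemperedDistributionCLM_apply, Submodule.coe_smul, map_smul,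
          ← TemperedDistribution.laplacianCLM_apply, RingHom.id_apply] at hu hcu ⊢
        rw [hu, hcu, smul_neg] }

/-! ### Multiplication operators -/

theorem mul_add_ae (d : ℕ) (V : Rd d → ℂ) (u v : L2 d) :
    (fun x => V x * u x) + (fun x => V x * v x) =ᵐ[volume] fun x => V x * (u + v : L2 d) x := by
  filter_upwards [Lp.coeFn_add u v] with x hx
  rw [hx, Pi.add_apply, Pi.add_apply, mul_add]

theorem mul_smul_ae (d : ℕ) (V : Rd d → ℂ) (c : ℂ) (u : L2 d) :
    c • (fun x => V x * u x) =ᵐ[volume] fun x => V x * (c • u : L2 d) x := by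
  filter_upwards [Lp.coeFn_smul c u] with x hx
  rw [hx, Pi.smul_apply, Pi.smul_apply, smul_eq_mul, smul_eq_mul, mul_left_comm]

/-- All square integrable `u` for which `V u` is square integrable. -/
def mulDomain (d : ℕ) (V : Rd d → ℂ) : Submodule ℂ (L2 d) where
  carrier := {u | MemLp (fun x => V x * u x) 2 volume}
  add_mem' {u v} hu hv := (MemLp.add hu hv).ae_eq (mul_add_ae d V u v)
  zero_mem' := by
    refine (MemLp.zero (ε := ℂ)).ae_eq ?_
    filter_upwards [Lp.coeFn_zero ℂ 2 (volume : Measure (Rd d))] with x hx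
    simp only [hx, Pi.zero_apply, mul_zero]
  smul_mem' c u hu := (MemLp.const_smul hu c).ae_eq (mul_smul_ae d V c u)

theorem memLp_mul (d : ℕ) (V : Rd d → ℂ) (u : mulDomain d V) :
    MemLp (fun x => V x * (u : L2 d) x) 2 volume := u.2

/-- The maximal operator of multiplication by `V`. -/
def mulOp (d : ℕ) (V : Rd d → ℂ) : L2 d →ₗ.[ℂ] L2 d where
  domain := mulDomain d V
  toFun :=
    { toFun := fun u => (memLp_mul d V u).toLp
      map_add' := fun u v => by
        rw [← MemLp.toLp_add, MemLp.toLp_eq_toLp_iff]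
        exact (mul_add_ae d V u v).symm
      map_smul' := fun c u => by
        rw [RingHom.id_apply, ← MemLp.toLp_const_smul, MemLp.toLp_eq_toLp_iff]
        exact (mul_smul_ae d V c u).symm }

/-- The bounded operator `K` is the product `B (H₀ + 1)⁻¹`: the domain of `B` contains the domain
of `H₀ = -Δ`, and `K` maps `(H₀ + 1) u` to `B u` for all `u` in the domain of `H₀`. (The map
`H₀ + 1` is a bijection from its domain onto the whole space.) -/
def IsProdFreeResolvent (d : ℕ) (B : L2 d →ₗ.[ℂ] L2 d) (K : L2 d →L[ℂ] L2 d) : Prop :=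
  ∀ u : (freeOp d).domain, ∃ h : (u : L2 d) ∈ B.domain,
    K (freeOp d u + (u : L2 d)) = B ⟨u, h⟩

/-! ### Dilation analytic potentials -/

/-- The open strip of all complex numbers with `|Im z| < α`. -/
def strip (α : ℝ) : Set ℂ := {z | |z.im| < α}

/-- The exponent `γ + d / 2`. -/
def lpExp (d : ℕ) (γ : ℝ) : ℝ≥0∞ := ENNReal.ofReal (γ + d / 2)

instance lpExp_fact (d : ℕ) (γ : ℝ) [hγ : Fact (1 ≤ γ)] : Fact (1 ≤ lpExp d γ) := by
  refine ⟨?_⟩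
  rw [lpExp, ENNReal.one_le_ofReal]
  have h1 : (1 : ℝ) ≤ γ := hγ.out
  have h2 : (0 : ℝ) ≤ (d : ℝ) / 2 := by positivity
  linarith

/-- The real dilation `x ↦ V (e ^ t x)` of a function. -/
def dilate {d : ℕ} (V : Rd d → ℂ) (t : ℝ) : Rd d → ℂ := fun x => V (Real.exp t • x)

/-- `W` is the analytic continuation of `t ↦ V (e ^ t ·)` from the real line to the strip, with
values in the Lebesgue space of exponent `γ + d / 2`. It is determined by `V` on the strip. -/
def IsDilationContinuation {d : ℕ} (γ α : ℝ) [Fact (1 ≤ γ)] (V : Rd d → ℂ)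
    (W : ℂ → Lp ℂ (lpExp d γ) (volume : Measure (Rd d))) : Prop :=
  AnalyticOnNhd ℂ W (strip α) ∧ ∀ t : ℝ, W (t : ℂ) =ᵐ[volume] dilate V t

/-- `V` is dilation analytic on the strip of half-width `α` (for the exponent `γ + d / 2`). -/
structure IsDilationAnalytic {d : ℕ} (γ α : ℝ) [Fact (1 ≤ γ)] (V : Rd d → ℂ) : Prop where
  memLp : MemLp V (lpExp d γ) volume
  compact : ∃ K : L2 d →L[ℂ] L2 d, IsProdFreeResolvent d (mulOp d V) K ∧ IsCompactOperator K
  continuation : ∃ W : ℂ → Lp ℂ (lpExp d γ) (volume : Measure (Rd d)),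
    IsDilationContinuation γ α V W
  resolvent_continuation : ∃ K : ℂ → (L2 d →L[ℂ] L2 d), AnalyticOnNhd ℂ K (strip α) ∧
    ∀ t : ℝ, IsProdFreeResolvent d (mulOp d (dilate V t)) (K (t : ℂ))

/-- The dilated Schrödinger operator `e ^ (-2 θ) H₀ + Q`, where `Q` is the dilated potential. The
sum has its natural domain, the intersection of the two domains. -/
def dilatedOp (d : ℕ) (θ : ℂ) (Q : Rd d → ℂ) : L2 d →ₗ.[ℂ] L2 d :=
  Complex.exp (-2 * θ) • freeOp d + mulOp d Q

/-! ### Spectra of unbounded operators -/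

section Spectrum

variable {X : Type*} [NormedAddCommGroup X] [NormedSpace ℂ X]

/-- The resolvent set: all `z` for which `T - z` is a bijection from the domain of `T` onto the
whole space and has a bounded inverse `R`. -/
def resolventSetOf (T : X →ₗ.[ℂ] X) : Set ℂ :=
  {z | ∃ R : X →L[ℂ] X,
    (∀ f : X, ∃ h : R f ∈ T.domain, T ⟨R f, h⟩ - z • R f = f) ∧
    ∀ u : T.domain, R (T u - z • (u : X)) = u}

/-- The spectrum of an unbounded operator. -/
def spectrumOf (T : X →ₗ.[ℂ] X) : Set ℂ := (resolventSetOf T)ᶜ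

/-- The number `z` is an eigenvalue of `T`. -/
def IsEigenvalueOf (T : X →ₗ.[ℂ] X) (z : ℂ) : Prop :=
  ∃ u : T.domain, (u : X) ≠ 0 ∧ T u = z • (u : X)

/-- The kernel of `(T - z) ^ k`, where `(T - z) ^ (k + 1)` is defined at those `u` in the domain
of `T` for which `(T - z) u` is in the domain of `(T - z) ^ k`. -/
def kerPow (T : X →ₗ.[ℂ] X) (z : ℂ) : ℕ → Submodule ℂ X
  | 0 => ⊥
  | k + 1 => ((kerPow T z k).comap (T.toFun - z • T.domain.subtype)).map T.domain.subtype

/-- The algebraic multiplicity, the supremum of the dimensions of the kernels of the powers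
of `T - z`. -/
def algMult (T : X →ₗ.[ℂ] X) (z : ℂ) : ℕ∞ :=
  ⨆ k : ℕ, Cardinal.toENat (Module.rank ℂ (kerPow T z k))

/-- The discrete spectrum: all eigenvalues of finite algebraic multiplicity that are isolated
points of the spectrum. -/
def discreteSpectrum (T : X →ₗ.[ℂ] X) : Set ℂ :=
  {z | IsEigenvalueOf T z ∧ (∃ ε > 0, Metric.ball z ε ∩ spectrumOf T = {z}) ∧ algMult T z < ⊤}

/-- The essential spectrum: the part of the spectrum that is not discrete. -/
def essentialSpectrum (T : X →ₗ.[ℂ] X) : Set ℂ := spectrumOf T \ discreteSpectrum T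

end Spectrum

/-- The half-line of all `e ^ (-2 θ) x` with `x ≥ 0`. -/
def rotatedHalfLine (θ : ℂ) : Set ℂ :=
  (fun x : ℝ => Complex.exp (-2 * θ) * (x : ℂ)) '' Ici 0

end DilationAnalytic

end

/-! Write `G = (H₀ + 1)⁻¹`, `c = e^(-2θ)` and `K = V_θ G`. The domain of `H(θ)` is the range of the
injective operator `G`, and `(H(θ) - z) G = B(z) := c - (c + z) G + K`. So `z` is in the resolvent
set exactly when the bounded operator `B(z)` is invertible, and the whole problem concerns this
family, affine in `z`.

On the Fourier side `G` is multiplication by `1 / (1 + 4π²|ξ|²)`, so it is a positive contraction;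
each `t` in `(0, 1]` lies in its spectrum without being an eigenvalue. Off the half-line `c [0, ∞)`
the operator `c - (c + z) G` is invertible, and `B(z)` is a compact perturbation of it. For `z = -c
(1 + r)` with `r` large, `B(z) = (1 + rG)(c + (1 + rG)⁻¹ K)` is invertible, because `(1 + rG)⁻¹`
tends to `0` strongly and `K` is compact. The complement of the half-line is connected, so
`analytic_fredholm` makes `B(z)⁻¹` meromorphic there. Its singularities are isolated, and the finite
pole order together with a finite-dimensional kernel bounds the algebraic multiplicity. On the
half-line, invertibility of `B(z)` would, by the Fredholm alternative, make the injective operator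
`c - (c + z) G` invertible, which it is not. The half-line is thus in the spectrum, and having no
isolated point it misses the discrete spectrum. This is `essentialSpectrum_eq_halfLine`.

It remains to see that the continued operators `K θ` are compact and equal `V_θ G`. For real `θ`,
dilations transport compactness from `V G`. For complex `θ`, the identity theorem applies modulo the
closed subspace of compact operators; applied to integrals over suitable bounded sets, it also
matches the two continuations (`ae_eq_mul_of_forall_real`). -/

namespace DilationAnalytic

/-! ### Finite-rank reduction and the local analytic Fredholm theorem -/

section Fredholm

variable {X : Type*} [NormedAddCommGroup X] [InnerProductSpace ℂ X]

/-- A compact operator on a Hilbert space is a norm limit of operators of finite rank. -/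
theorem exists_finiteRank_approx {K : X →L[ℂ] X} (hK : IsCompactOperator K) {ε : ℝ}
    (hε : 0 < ε) :
    ∃ (n : ℕ) (e : Fin n → X) (φ : Fin n → (X →L[ℂ] ℂ)),
      ‖K - ∑ i, (φ i).smulRight (e i)‖ < ε := by
  have hT : TotallyBounded (K '' Metric.closedBall 0 1) :=
    (hK.isCompact_closure_image_closedBall (f := (K : X →ₗ[ℂ] X)) 1).totallyBounded.subset
      subset_closure
  -- Project `K` orthogonally onto the span of a finite `ε / 2`-net of the image of the unit ball:
  -- the projection of `K x` is at least as close to `K x` as the nearest point of the net.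
  obtain ⟨t, ht, hcov⟩ := Metric.totallyBounded_iff.mp hT (ε / 2) (half_pos hε)
  let S : Submodule ℂ X := Submodule.span ℂ t
  have : FiniteDimensional ℂ S := FiniteDimensional.span_of_finite ℂ ht
  let b := stdOrthonormalBasis ℂ S
  refine ⟨_, fun i => (b i : X), fun i => (innerSL ℂ (b i : X)).comp K, ?_⟩
  refine lt_of_le_of_lt ?_ (half_lt_self hε)
  have hP : ∀ x, (∑ i, ((innerSL ℂ (b i : X)).comp K).smulRight (b i : X)) x =
      S.starProjection (K x) := by
    intro x
    rw [b.starProjection_eq_sum_rankOne]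
    simp
  refine ContinuousLinearMap.opNorm_le_of_unit_norm (half_pos hε).le fun x hx => ?_
  rw [sub_apply, hP]
  have hmem : K x ∈ K '' Metric.closedBall 0 1 :=
    mem_image_of_mem _ (by simp [hx])
  obtain ⟨y, hy, hxy⟩ := mem_iUnion₂.mp (hcov hmem)
  rw [S.starProjection_minimal]
  refine (ciInf_le ⟨0, ?_⟩ (⟨y, Submodule.subset_span hy⟩ : S)).trans ?_
  · rintro _ ⟨z, rfl⟩
    positivity
  · rw [← dist_eq_norm]
    exact (Metric.mem_ball.mp hxy).le

/-- The matrix whose determinant detects invertibility of `1 + J F`, `F = ∑ i, φ i ⊗ e i`. -/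
noncomputable def reductionMatrix {n : ℕ} (e : Fin n → X) (φ : Fin n → (X →L[ℂ] ℂ))
    (J : X →L[ℂ] X) : Matrix (Fin n) (Fin n) ℂ :=
  1 + Matrix.of fun j i => φ j (J (e i))

/-- The numerator in Cramer's rule for the inverse of `J⁻¹ + F`, `F = ∑ i, φ i ⊗ e i`. -/
noncomputable def cramerNumerator {n : ℕ} (e : Fin n → X) (φ : Fin n → (X →L[ℂ] ℂ))
    (J : X →L[ℂ] X) : X →L[ℂ] X :=
  (reductionMatrix e φ J).det • J -
    ∑ i, ∑ j, (reductionMatrix e φ J).adjugate i j • ((φ j).comp J).smulRight (J (e i))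

theorem cramerNumerator_apply {n : ℕ} (e : Fin n → X) (φ : Fin n → (X →L[ℂ] ℂ))
    (J : X →L[ℂ] X) (y : X) :
    cramerNumerator e φ J y = (reductionMatrix e φ J).det • J y -
      ∑ i, ((reductionMatrix e φ J).adjugate.mulVec (fun j => φ j (J y))) i • J (e i) := by
  simp only [cramerNumerator, sub_apply, smul_apply,
    sum_apply, ContinuousLinearMap.smulRight_apply,
    ContinuousLinearMap.comp_apply, Matrix.mulVec, dotProduct, Finset.sum_smul, smul_smul]

theorem reductionMatrix_mulVec {n : ℕ} (e : Fin n → X) (φ : Fin n → (X →L[ℂ] ℂ))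
    (J : X →L[ℂ] X) (a : Fin n → ℂ) (k : Fin n) :
    ((reductionMatrix e φ J).mulVec a) k = a k + φ k (∑ i, a i • J (e i)) := by
  rw [reductionMatrix, Matrix.add_mulVec, Matrix.one_mulVec, Pi.add_apply, map_sum]
  congr 1
  simp only [Matrix.mulVec, dotProduct, Matrix.of_apply, map_smul, smul_eq_mul]
  exact Finset.sum_congr rfl fun i _ => mul_comm _ _

/-- With `a = adj(M) φ(J y)`, the vector `x = det M • J y - ∑ a i • J (e i)` satisfies `φ k x = a
k`, so the finite-rank term cancels the sum in `E x`. Nothing is divided by the determinant, so the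
identity survives at its zeros. -/
theorem mul_cramerNumerator {n : ℕ} (e : Fin n → X) (φ : Fin n → (X →L[ℂ] ℂ))
    {E J : X →L[ℂ] X} (hEJ : E * J = 1) :
    (E + ∑ i, (φ i).smulRight (e i)) * cramerNumerator e φ J =
      (reductionMatrix e φ J).det • 1 := by
  have h1 : ∀ x, E (J x) = x := fun x => DFunLike.congr_fun hEJ x
  ext y
  set M := reductionMatrix e φ J with hM
  set a := M.adjugate.mulVec (fun j => φ j (J y)) with ha
  have hMa : ∀ k, a k + φ k (∑ i, a i • J (e i)) = M.det * φ k (J y) := by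
    intro k
    rw [← reductionMatrix_mulVec, ← hM, ha, Matrix.mulVec_mulVec, Matrix.mul_adjugate,
      Matrix.smul_mulVec, Matrix.one_mulVec, Pi.smul_apply, smul_eq_mul]
  have h2 : ∀ k, φ k (M.det • J y - ∑ i, a i • J (e i)) = a k := by
    intro k
    rw [map_sub, map_smul, smul_eq_mul, ← hMa k]
    ring
  rw [mul_apply_eq_comp, cramerNumerator_apply, ← hM, ← ha,
    add_apply, sum_apply]
  simp only [ContinuousLinearMap.smulRight_apply, h2]
  simp [h1]

theorem cramerNumerator_mul {n : ℕ} (e : Fin n → X) (φ : Fin n → (X →L[ℂ] ℂ))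
    {E J : X →L[ℂ] X} (hJE : J * E = 1) :
    cramerNumerator e φ J * (E + ∑ i, (φ i).smulRight (e i)) =
      (reductionMatrix e φ J).det • 1 := by
  have h1 : ∀ x, J (E x) = x := fun x => DFunLike.congr_fun hJE x
  ext x
  set M := reductionMatrix e φ J with hM
  have hw : J ((E + ∑ i, (φ i).smulRight (e i)) x) = x + ∑ i, φ i x • J (e i) := by
    simp [h1]
  have h2 : (fun j => φ j (x + ∑ i, φ i x • J (e i))) = M.mulVec (fun j => φ j x) := by
    ext k
    rw [hM, reductionMatrix_mulVec, map_add]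
  rw [mul_apply_eq_comp, cramerNumerator_apply, ← hM, hw, h2, Matrix.mulVec_mulVec,
    Matrix.adjugate_mul, Matrix.smul_mulVec, Matrix.one_mulVec]
  simp [smul_add, Finset.smul_sum, smul_smul]

/-- A null vector `a` of the matrix gives the kernel element `∑ a i • J (e i)`; it is nonzero
because the functionals `φ k` recover `-a k` from it. -/
theorem not_injective_of_det_eq_zero {n : ℕ} (e : Fin n → X) (φ : Fin n → (X →L[ℂ] ℂ))
    {E J : X →L[ℂ] X} (hEJ : E * J = 1) (hdet : (reductionMatrix e φ J).det = 0) :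
    ¬ Function.Injective (E + ∑ i, (φ i).smulRight (e i)) := by
  have h1 : ∀ x, E (J x) = x := fun x => DFunLike.congr_fun hEJ x
  obtain ⟨a, ha0, ha⟩ := Matrix.exists_mulVec_eq_zero_iff.mpr hdet
  have h2 : ∀ k, φ k (∑ i, a i • J (e i)) = -a k := by
    intro k
    have := congrFun ha k
    rw [reductionMatrix_mulVec, Pi.zero_apply] at this
    exact eq_neg_of_add_eq_zero_right this
  intro hinj
  have h3 : (E + ∑ i, (φ i).smulRight (e i)) (∑ i, a i • J (e i)) = 0 := by
    rw [add_apply, sum_apply]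
    simp only [ContinuousLinearMap.smulRight_apply, h2]
    simp [h1]
  have h4 : ∑ i, a i • J (e i) = 0 := hinj (by rw [h3, map_zero])
  refine ha0 (funext fun k => ?_)
  have := h2 k
  rw [h4, map_zero] at this
  simpa using this.symm

theorem continuousAt_cramerNumerator {n : ℕ} (e : Fin n → X) (φ : Fin n → (X →L[ℂ] ℂ))
    {J : ℂ → X →L[ℂ] X} {z₁ : ℂ} (hJ : ContinuousAt J z₁) :
    ContinuousAt (fun z => cramerNumerator e φ (J z)) z₁ := by
  have hc : Continuous fun L : X →L[ℂ] X => cramerNumerator e φ L := by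
    have hM : Continuous fun L : X →L[ℂ] X => reductionMatrix e φ L := by
      refine continuous_const.add (continuous_matrix fun j i => ?_)
      simp only [Matrix.of_apply]
      fun_prop
    have hdet := hM.matrix_det
    have hadj := hM.matrix_adjugate
    unfold cramerNumerator
    refine (hdet.smul continuous_id).sub (continuous_finsetSum _ fun i _ =>
      continuous_finsetSum _ fun j _ => ?_)
    refine (hadj.matrix_elem i j).smul ?_
    have h1 : Continuous fun L : X →L[ℂ] X => (φ j).comp L := by fun_prop
    have h2 : Continuous fun L : X →L[ℂ] X => L (e i) := by fun_prop
    exact ((ContinuousLinearMap.smulRightL ℂ X X).continuous.comp h1).clm_apply h2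
  exact hc.continuousAt.comp hJ

theorem analyticAt_det_reductionMatrix {n : ℕ} (e : Fin n → X) (φ : Fin n → (X →L[ℂ] ℂ))
    {J : ℂ → X →L[ℂ] X} {z₁ : ℂ} (hJ : AnalyticAt ℂ J z₁) :
    AnalyticAt ℂ (fun z => (reductionMatrix e φ (J z)).det) z₁ := by
  simp only [Matrix.det_apply]
  refine Finset.analyticAt_fun_sum _ fun σ _ => ?_
  refine AnalyticAt.const_smul ?_
  refine Finset.analyticAt_fun_prod _ fun i _ => ?_
  simp only [reductionMatrix, Matrix.add_apply, Matrix.of_apply]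
  refine analyticAt_const.add ?_
  exact ((φ (σ i)).comp (ContinuousLinearMap.apply ℂ X (e i))).analyticAt _ |>.comp hJ

/-- Local form of the analytic Fredholm theorem. -/
theorem local_analytic_fredholm [CompleteSpace X] {B : ℂ → X →L[ℂ] X} {z₁ : ℂ}
    (hB : AnalyticAt ℂ B z₁) {D K : X →L[ℂ] X} (hD : IsUnit D) (hK : IsCompactOperator K) (hDK : B z₁ = D + K) :
    (∃ (g : ℂ → ℂ) (N : ℂ → X →L[ℂ] X), AnalyticAt ℂ g z₁ ∧ ContinuousAt N z₁ ∧
      ∀ᶠ z in 𝓝 z₁, B z * N z = g z • 1 ∧ N z * B z = g z • 1 ∧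
        (g z = 0 → ¬ Function.Injective (B z))) ∧
    FiniteDimensional ℂ (LinearMap.ker (B z₁ : X →ₗ[ℂ] X)) := by
  obtain ⟨ε, hε, hball⟩ := Metric.isOpen_iff.mp (Units.isOpen (R := X →L[ℂ] X)) D hD
  obtain ⟨n, e, φ, hF⟩ := exists_finiteRank_approx hK hε
  set F : X →L[ℂ] X := ∑ i, (φ i).smulRight (e i) with hFdef
  -- At `z₁` this is `D + (K - F)`, within `ε` of `D`, hence invertible there and nearby. Then `B =
  -- E + F` with `E` invertible and `F` of finite rank.
  let E : ℂ → X →L[ℂ] X := fun z => B z - F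
  have hEan : AnalyticAt ℂ E z₁ := hB.sub analyticAt_const
  have hE1 : IsUnit (E z₁) := by
    refine hball ?_
    rw [Metric.mem_ball, dist_eq_norm]
    have h : E z₁ - D = K - F := by simp only [E, hDK]; abel
    rwa [h]
  have hEu : ∀ᶠ z in 𝓝 z₁, IsUnit (E z) :=
    hEan.continuousAt.eventually (Units.isOpen.mem_nhds hE1)
  let J : ℂ → X →L[ℂ] X := fun z => Ring.inverse (E z)
  have hJan : AnalyticAt ℂ J z₁ := by
    have h := analyticAt_inverse (𝕜 := ℂ) hE1.unit
    rw [IsUnit.unit_spec] at h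
    exact h.comp hEan
  have hBE : ∀ z, B z = E z + F := fun z => (sub_add_cancel _ _).symm
  refine ⟨⟨fun z => (reductionMatrix e φ (J z)).det, fun z => cramerNumerator e φ (J z),
    analyticAt_det_reductionMatrix e φ hJan, continuousAt_cramerNumerator e φ hJan.continuousAt,
    ?_⟩, ?_⟩
  · filter_upwards [hEu] with z hz
    have hEJ : E z * J z = 1 := Ring.mul_inverse_cancel _ hz
    have hJE : J z * E z = 1 := Ring.inverse_mul_cancel _ hz
    rw [hBE, hFdef]
    exact ⟨mul_cramerNumerator e φ hEJ, cramerNumerator_mul e φ hJE,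
      not_injective_of_det_eq_zero e φ hEJ⟩
  · let S : Submodule ℂ X := Submodule.span ℂ (range fun i => J z₁ (e i))
    have : FiniteDimensional ℂ S := FiniteDimensional.span_of_finite ℂ (finite_range _)
    refine Submodule.finiteDimensional_of_le (S₂ := S) fun x hx => ?_
    have hx0 : E z₁ x + F x = 0 := by
      have : B z₁ x = 0 := hx
      rwa [hBE] at this
    have hJE : J z₁ * E z₁ = 1 := Ring.inverse_mul_cancel _ hE1
    have hx1 : x = -J z₁ (F x) := by
      rw [← map_neg, ← eq_neg_of_add_eq_zero_left hx0]
      exact (DFunLike.congr_fun hJE x).symm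
    rw [hx1, hFdef]
    refine S.neg_mem ?_
    simp only [sum_apply, ContinuousLinearMap.smulRight_apply, map_sum,
      map_smul]
    exact S.sum_mem fun i _ => S.smul_mem _ (Submodule.subset_span ⟨i, rfl⟩)

end Fredholm

/-! ### Kernels of powers and the order of a resolvent pole -/

section KerPow

variable {X : Type*} [NormedAddCommGroup X] [NormedSpace ℂ X] {T : X →ₗ.[ℂ] X} {z : ℂ}

theorem mem_kerPow_succ {k : ℕ} {u : X} :
    u ∈ kerPow T z (k + 1) ↔ ∃ h : u ∈ T.domain, T ⟨u, h⟩ - z • u ∈ kerPow T z k := by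
  simp only [kerPow, Submodule.mem_map, Submodule.mem_comap]
  constructor
  · rintro ⟨v, hv, rfl⟩
    exact ⟨v.2, hv⟩
  · rintro ⟨h, hu⟩
    exact ⟨⟨u, h⟩, hu, rfl⟩

theorem kerPow_le_succ (k : ℕ) : kerPow T z k ≤ kerPow T z (k + 1) := by
  induction k with
  | zero => exact bot_le
  | succ k ih =>
    intro u hu
    obtain ⟨h, hu⟩ := mem_kerPow_succ.mp hu
    exact mem_kerPow_succ.mpr ⟨h, ih hu⟩

theorem kerPow_mono : Monotone (kerPow T z) := monotone_nat_of_le_succ kerPow_le_succ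

/-- `T - z` maps each kernel into the preceding one, and its own kernel is finite-dimensional;
induct by rank-nullity. -/
theorem finiteDimensional_kerPow
    (hker : FiniteDimensional ℂ (LinearMap.ker (T.toFun - z • T.domain.subtype))) (k : ℕ) :
    FiniteDimensional ℂ (kerPow T z k) := by
  induction k with
  | zero => exact inferInstanceAs (FiniteDimensional ℂ (⊥ : Submodule ℂ X))
  | succ k ih =>
    have : FiniteDimensional ℂ
        ((kerPow T z k).comap (T.toFun - z • T.domain.subtype)) := by
      let L := (T.toFun - z • T.domain.subtype).restrict
        (p := (kerPow T z k).comap (T.toFun - z • T.domain.subtype)) (q := kerPow T z k)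
        fun x hx => hx
      have h1 : FiniteDimensional ℂ (LinearMap.range L) := inferInstance
      have h2 : FiniteDimensional ℂ (LinearMap.ker L) := by
        refine Module.Finite.of_injective
          (M := LinearMap.ker L)
          (N := LinearMap.ker (T.toFun - z • T.domain.subtype))
          (((kerPow T z k).comap (T.toFun - z • T.domain.subtype)).subtype.comp
            (LinearMap.ker L).subtype |>.codRestrict _
              fun x => congrArg Subtype.val (LinearMap.mem_ker.mp x.2)) ?_
        intro x y hxy
        have := congrArg (fun w => w.1) hxy
        exact Subtype.ext (Subtype.ext this)
      have h3 := Module.Finite.equiv L.quotKerEquivRange.symm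
      exact Module.Finite.of_submodule_quotient (LinearMap.ker L)
    exact Module.Finite.map _ _

/-- If the resolvent has a pole of order at most `n` at `z`, the kernels of the powers of `T - z`
do not grow after step `n`. -/
theorem kerPow_succ_le_of_tendsto {R : ℂ → X →L[ℂ] X}
    (hR : ∀ᶠ w in 𝓝[≠] z, ∀ u : T.domain, R w (T u - w • (u : X)) = u) (k : ℕ) :
    ∀ v ∈ kerPow T z (k + 1),
      Filter.Tendsto (fun w => (w - z) ^ (k + 1) • R w v) (𝓝[≠] z) (𝓝 0) →
      v ∈ kerPow T z k := by
  -- Each application of `T - z` trades one factor `w - z` in front of `R w v`, up to a term that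
  -- vanishes in the limit; this drives the induction.
  have key : ∀ v, ∀ h : v ∈ T.domain, ∀ᶠ w in 𝓝[≠] z,
      R w (T ⟨v, h⟩ - z • v) = v + (w - z) • R w v := by
    intro v h
    filter_upwards [hR] with w hw
    have h1 : T ⟨v, h⟩ - z • v = (T ⟨v, h⟩ - w • v) + (w - z) • v := by
      rw [sub_smul]; abel
    rw [h1, map_add, map_smul]
    congr 1
    exact hw ⟨v, h⟩
  induction k with
  | zero =>
    intro v hv hlim
    obtain ⟨h, hv⟩ := mem_kerPow_succ.mp hv
    have hv0 : T ⟨v, h⟩ - z • v = 0 := hv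
    have h2 : ∀ᶠ w in 𝓝[≠] z, (w - z) ^ (0 + 1) • R w v = -v := by
      filter_upwards [key v h] with w hw
      rw [hv0, map_zero] at hw
      rw [zero_add, pow_one]
      exact eq_neg_of_add_eq_zero_right hw.symm
    have h3 : (0 : X) = -v :=
      tendsto_nhds_unique hlim (tendsto_const_nhds.congr' (h2.mono fun _ h => h.symm))
    have h4 : v = 0 := by simpa using h3.symm
    rw [h4]
    exact Submodule.zero_mem _
  | succ k ih =>
    intro v hv hlim
    obtain ⟨h, hv⟩ := mem_kerPow_succ.mp hv
    refine mem_kerPow_succ.mpr ⟨h, ih _ hv ?_⟩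
    have h1 : Filter.Tendsto (fun w => (w - z) ^ (k + 1) • v) (𝓝[≠] z) (𝓝 0) := by
      have hc : Continuous fun w : ℂ => (w - z) ^ (k + 1) • v := by fun_prop
      have := hc.tendsto z
      simp only [sub_self, ne_eq, Nat.add_eq_zero_iff, one_ne_zero, and_false,
        not_false_eq_true, zero_pow, zero_smul] at this
      exact this.mono_left nhdsWithin_le_nhds
    have h2 := h1.add hlim
    rw [add_zero] at h2
    refine h2.congr' ?_
    filter_upwards [key v h] with w hw
    rw [hw, smul_add, smul_smul, ← pow_succ]

/-- The pole bound forces `(w - z) ^ (k + 1) • R w v → 0` once `k ≥ n`, so the kernels stop growing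
at step `n`, where the dimension is finite. -/
theorem algMult_lt_top_of_pole
    (hker : FiniteDimensional ℂ (LinearMap.ker (T.toFun - z • T.domain.subtype)))
    {R : ℂ → X →L[ℂ] X}
    (hR : ∀ᶠ w in 𝓝[≠] z, ∀ u : T.domain, R w (T u - w • (u : X)) = u)
    {n : ℕ} {C : ℝ} (hC : ∀ᶠ w in 𝓝[≠] z, ‖(w - z) ^ n • R w‖ ≤ C) :
    algMult T z < ⊤ := by
  have hstep : ∀ k, n ≤ k → kerPow T z (k + 1) ≤ kerPow T z k := by
    intro k hk v hv
    refine kerPow_succ_le_of_tendsto hR k v hv ?_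
    have h1 : Filter.Tendsto (fun w => ‖(w - z) ^ (k + 1 - n)‖ * (C * ‖v‖)) (𝓝[≠] z)
        (𝓝 0) := by
      have hc : Continuous fun w : ℂ => ‖(w - z) ^ (k + 1 - n)‖ * (C * ‖v‖) := by fun_prop
      have h := hc.tendsto z
      rw [sub_self, zero_pow (by omega), norm_zero, zero_mul] at h
      exact h.mono_left nhdsWithin_le_nhds
    refine squeeze_zero_norm' ?_ h1
    filter_upwards [hC] with w hw
    have h2 : (w - z) ^ (k + 1) • R w v =
        (w - z) ^ (k + 1 - n) • (((w - z) ^ n • R w) v) := by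
      rw [smul_apply, smul_smul, ← pow_add, Nat.sub_add_cancel (by omega)]
    rw [h2, norm_smul]
    gcongr
    exact (ContinuousLinearMap.le_opNorm _ _).trans (by gcongr)
  have hle : ∀ k, kerPow T z k ≤ kerPow T z n := by
    intro k
    rcases le_total k n with h | h
    · exact kerPow_mono h
    · induction k, h using Nat.le_induction with
      | base => exact le_rfl
      | succ k hk ih => exact (hstep k hk).trans ih
  have hfin := finiteDimensional_kerPow hker n
  refine lt_of_le_of_lt (b := Cardinal.toENat (Module.rank ℂ (kerPow T z n)))
    (iSup_le fun k => ?_) ?_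
  · exact OrderHomClass.mono Cardinal.toENat (Submodule.rank_mono (hle k))
  · rw [Cardinal.toENat_lt_top]
    exact Module.rank_lt_aleph0 ℂ _

end KerPow

/-! ### Fredholm alternative and meromorphic inverses -/

section AnalyticFamily

variable {X : Type*} [NormedAddCommGroup X] [InnerProductSpace ℂ X]

theorem isUnit_of_mul_eq_smul_one {A N : X →L[ℂ] X} {g : ℂ} (hg : g ≠ 0)
    (h1 : A * N = g • 1) (h2 : N * A = g • 1) :
    IsUnit A ∧ Ring.inverse A = g⁻¹ • N := by
  have h3 : A * (g⁻¹ • N) = 1 := by rw [mul_smul_comm, h1, smul_smul, inv_mul_cancel₀ hg, one_smul]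
  have h4 : (g⁻¹ • N) * A = 1 := by rw [smul_mul_assoc, h2, smul_smul, inv_mul_cancel₀ hg, one_smul]
  let U : (X →L[ℂ] X)ˣ := ⟨A, g⁻¹ • N, h3, h4⟩
  exact ⟨U.isUnit, Ring.inverse_unit U⟩

theorem not_isUnit_of_not_injective [CompleteSpace X] {A : X →L[ℂ] X}
    (h : ¬ Function.Injective A) : ¬ IsUnit A :=
  fun hA => h (ContinuousLinearMap.isUnit_iff_bijective.mp hA).1

/-- Fredholm alternative for a compact perturbation of an invertible operator. -/
theorem isUnit_of_injective_add_compact [CompleteSpace X] {D K : X →L[ℂ] X} (hD : IsUnit D)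
    (hK : IsCompactOperator K) (hinj : Function.Injective (D + K)) : IsUnit (D + K) := by
  obtain ⟨⟨g, N, -, -, h⟩, -⟩ := local_analytic_fredholm (B := fun _ => D + K) (z₁ := 0)
    analyticAt_const hD hK rfl
  obtain ⟨h1, h2, h3⟩ := h.self_of_nhds
  exact (isUnit_of_mul_eq_smul_one (fun h0 => h3 h0 hinj) h1 h2).1

/-- Analytic Fredholm theorem: invertibility of an analytic family of compact perturbations of
invertible operators at one point of a connected set makes the inverse meromorphic there. -/
theorem analytic_fredholm [CompleteSpace X] {B : ℂ → X →L[ℂ] X} {Ω : Set ℂ} (hΩ : IsPreconnected Ω)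
    (hB : AnalyticOnNhd ℂ B Ω)
    (hDK : ∀ z ∈ Ω, ∃ D K : X →L[ℂ] X, IsUnit D ∧ IsCompactOperator K ∧ B z = D + K)
    {z₀ : ℂ} (hz₀ : z₀ ∈ Ω) (hz₀u : IsUnit (B z₀)) {z₁ : ℂ} (hz₁ : z₁ ∈ Ω) :
    ∃ (n : ℕ) (C : ℝ), ∀ᶠ z in 𝓝[≠] z₁,
      IsUnit (B z) ∧ ‖(z - z₁) ^ n • Ring.inverse (B z)‖ ≤ C := by
  have hloc : ∀ z ∈ Ω, ∃ (g : ℂ → ℂ) (N : ℂ → X →L[ℂ] X), AnalyticAt ℂ g z ∧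
      ContinuousAt N z ∧ ∀ᶠ w in 𝓝 z, B w * N w = g w • 1 ∧ N w * B w = g w • 1 ∧
        (g w = 0 → ¬ Function.Injective (B w)) := by
    intro z hz
    obtain ⟨D, K, hD, hK, h⟩ := hDK z hz
    exact (local_analytic_fredholm (hB z hz) hD hK h).1
  -- The interior of the non-invertible set is open, and it is relatively closed in `Ω` because
  -- locally `g` vanishes identically or only at isolated points. Connectedness and `z₀` exclude it
  -- from `Ω`.
  let U : Set ℂ := {z | ∀ᶠ w in 𝓝 z, ¬ IsUnit (B w)}
  have hUo : IsOpen U := isOpen_setOfPred_eventually_nhds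
  have hUe : ¬ (Ω ∩ U).Nonempty := by
    intro hne
    refine (hΩ.subset_of_closure_inter_subset hUo hne ?_ hz₀ : z₀ ∈ U).self_of_nhds hz₀u
    rintro z ⟨hzU, hzΩ⟩
    obtain ⟨g, N, hg, -, h⟩ := hloc z hzΩ
    rcases hg.eventually_eq_zero_or_eventually_ne_zero with h0 | h0
    · filter_upwards [h0, h] with w hw0 hw
      exact not_isUnit_of_not_injective (hw.2.2 hw0)
    · exfalso
      have hev : ∀ᶠ w in 𝓝 z, w ≠ z → IsUnit (B w) := by
        filter_upwards [eventually_nhdsWithin_iff.mp h0, h] with w hw0 hw hwz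
        exact (isUnit_of_mul_eq_smul_one (hw0 hwz) hw.1 hw.2.1).1
      obtain ⟨w, hwU, hw⟩ := ((mem_closure_iff_frequently.mp hzU).and_eventually
        hev.eventually_nhds).exists
      have hfr : ∃ᶠ v in 𝓝[≠] w, v ≠ z := by
        refine Filter.Eventually.frequently ?_
        rcases eq_or_ne w z with rfl | hwz
        · exact self_mem_nhdsWithin
        · exact (isOpen_ne.mem_nhds hwz : _) |> nhdsWithin_le_nhds
      obtain ⟨v, hvz, hv1, hv2⟩ := (hfr.and_eventually
        ((hwU.and hw).filter_mono nhdsWithin_le_nhds)).exists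
      exact hv1 (hv2 hvz)
  obtain ⟨g, N, hg, hN, h⟩ := hloc z₁ hz₁
  have hg0 : ¬ ∀ᶠ z in 𝓝 z₁, g z = 0 := by
    intro h0
    refine hUe ⟨z₁, hz₁, ?_⟩
    filter_upwards [h0, h] with w hw0 hw
    exact not_isUnit_of_not_injective (hw.2.2 hw0)
  -- The inverse is `g⁻¹ • N` with `N` bounded near `z₁`, so the order of the zero of `g` bounds the
  -- order of the pole.
  obtain ⟨n, q, hq, hq0, hgq⟩ := hg.exists_eventuallyEq_pow_smul_nonzero_iff.mpr hg0
  have hcont : ContinuousAt (fun z => ‖(q z)⁻¹ • N z‖) z₁ :=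
    ((hq.continuousAt.inv₀ hq0).smul hN).norm
  refine ⟨n, ‖(q z₁)⁻¹ • N z₁‖ + 1, ?_⟩
  have hbd : ∀ᶠ z in 𝓝 z₁, ‖(q z)⁻¹ • N z‖ < ‖(q z₁)⁻¹ • N z₁‖ + 1 :=
    hcont.eventually_lt_const (lt_add_one _)
  rw [eventually_nhdsWithin_iff]
  filter_upwards [hbd, hgq, h, hq.continuousAt.eventually_ne hq0] with z h1 h2 h3 h4 h5
  have h6 : (z - z₁) ^ n ≠ 0 := pow_ne_zero _ (sub_ne_zero.mpr h5)
  have h7 : g z ≠ 0 := by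
    rw [h2]
    exact smul_ne_zero h6 h4
  obtain ⟨h8, h9⟩ := isUnit_of_mul_eq_smul_one h7 h3.1 h3.2.1
  refine ⟨h8, ?_⟩
  rw [h9, h2, smul_smul, smul_eq_mul, mul_inv, mul_inv_cancel_left₀ h6]
  exact h1.le

end AnalyticFamily

/-! ### Positive contractions and the decay of `(1 + rG)⁻¹` -/

section PositiveOperator

variable {X : Type*} [NormedAddCommGroup X] [InnerProductSpace ℂ X]

theorem norm_le_norm_one_add_smul {G : X →L[ℂ] X} (hG : G.IsPositive) {r : ℝ} (hr : 0 < r)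
    (x : X) : ‖x‖ ≤ ‖(1 + (r : ℂ) • G) x‖ := by
  have h1 : ‖x‖ ^ 2 ≤ RCLike.re (inner ℂ x ((1 + (r : ℂ) • G) x)) := by
    have h2 : inner ℂ x ((1 + (r : ℂ) • G) x) = inner ℂ x x + (r : ℂ) * inner ℂ x (G x) := by
      rw [add_apply, smul_apply, inner_add_right, inner_smul_right]
      rfl
    have h3 : 0 ≤ RCLike.re (inner ℂ x (G x)) := hG.re_inner_nonneg_right x
    rw [h2, map_add, inner_self_eq_norm_sq]
    have h4 : RCLike.re ((r : ℂ) * inner ℂ x (G x)) = r * RCLike.re (inner ℂ x (G x)) := by simp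
    rw [h4]
    nlinarith [mul_nonneg hr.le h3]
  have h5 : RCLike.re (inner ℂ x ((1 + (r : ℂ) • G) x)) ≤ ‖x‖ * ‖(1 + (r : ℂ) • G) x‖ :=
    (RCLike.re_le_norm _).trans (norm_inner_le_norm _ _)
  rcases (norm_nonneg x).eq_or_lt with h | h
  · rw [← h]
    positivity
  · exact le_of_mul_le_mul_left (by nlinarith) h

variable [CompleteSpace X]

theorem spectrum_subset_unitInterval {G : X →L[ℂ] X} (hG : G.IsPositive) (hG1 : ‖G‖ ≤ 1) {s : ℂ}
    (hs : s ∈ spectrum ℂ G) : ∃ t : ℝ, 0 ≤ t ∧ t ≤ 1 ∧ s = t := by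
  have hre : s = s.re := hG.isSelfAdjoint.mem_spectrum_eq_re hs
  have hnn : (0 : X →L[ℂ] X) ≤ G := (ContinuousLinearMap.nonneg_iff_isPositive G).mpr hG
  refine ⟨s.re, ?_, ?_, hre⟩
  · refine spectrum_nonneg_of_nonneg (𝕜 := ℝ) hnn ?_
    rw [← spectrum.algebraMap_mem_iff ℂ]
    rw [hre] at hs
    exact hs
  · have h1 : ‖(1 : X →L[ℂ] X)‖ ≤ 1 := ContinuousLinearMap.norm_id_le
    calc s.re ≤ ‖s‖ := Complex.re_le_norm s
      _ ≤ ‖G‖ * ‖(1 : X →L[ℂ] X)‖ := spectrum.norm_le_norm_mul_of_mem hs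
      _ ≤ 1 * 1 := by gcongr
      _ = 1 := one_mul 1

theorem isUnit_smul_one_sub {G : X →L[ℂ] X} (hG : G.IsPositive) (hG1 : ‖G‖ ≤ 1) {s : ℂ}
    (hs : ∀ t : ℝ, 0 ≤ t → t ≤ 1 → s ≠ t) : IsUnit (s • (1 : X →L[ℂ] X) - G) := by
  have h : s ∉ spectrum ℂ G := by
    intro h
    obtain ⟨t, h0, h1, h2⟩ := spectrum_subset_unitInterval hG hG1 h
    exact hs t h0 h1 h2
  rw [spectrum.notMem_iff, Algebra.algebraMap_eq_smul_one] at h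
  exact h

theorem isUnit_one_add_smul {G : X →L[ℂ] X} (hG : G.IsPositive) (hG1 : ‖G‖ ≤ 1) {r : ℝ}
    (hr : 0 < r) : IsUnit (1 + (r : ℂ) • G) := by
  have hr0 : (r : ℂ) ≠ 0 := by exact_mod_cast hr.ne'
  have h : IsUnit ((-(r : ℂ)⁻¹) • (1 : X →L[ℂ] X) - G) := by
    refine isUnit_smul_one_sub hG hG1 fun t ht _ h => ?_
    have h1 : -r⁻¹ = t := by exact_mod_cast h
    have h2 : 0 < r⁻¹ := inv_pos.mpr hr
    linarith
  have h2 : 1 + (r : ℂ) • G = (-(r : ℂ)) • ((-(r : ℂ)⁻¹) • (1 : X →L[ℂ] X) - G) := by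
    rw [smul_sub, smul_smul, neg_mul_neg, mul_inv_cancel₀ hr0, one_smul, neg_smul, sub_neg_eq_add]
  rw [h2]
  exact h.smul (Units.mk0 (-(r : ℂ)) (neg_ne_zero.mpr hr0))

theorem norm_inverse_one_add_smul_le {G : X →L[ℂ] X} (hG : G.IsPositive) (hG1 : ‖G‖ ≤ 1) {r : ℝ}
    (hr : 0 < r) : ‖Ring.inverse (1 + (r : ℂ) • G)‖ ≤ 1 := by
  refine ContinuousLinearMap.opNorm_le_bound _ zero_le_one fun x => ?_
  have h := norm_le_norm_one_add_smul hG hr (Ring.inverse (1 + (r : ℂ) • G) x)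
  have h2 : (1 + (r : ℂ) • G) (Ring.inverse (1 + (r : ℂ) • G) x) = x :=
    DFunLike.congr_fun (Ring.mul_inverse_cancel _ (isUnit_one_add_smul hG hG1 hr)) x
  rwa [h2, ← one_mul ‖x‖] at h

theorem denseRange_of_isPositive {G : X →L[ℂ] X} (hG : G.IsPositive)
    (hinj : Function.Injective G) : DenseRange G := by
  have h : (LinearMap.range (G : X →ₗ[ℂ] X))ᗮ = ⊥ := by
    rw [Submodule.eq_bot_iff]
    intro x hx
    have h1 : ∀ y, inner ℂ y (G x) = 0 := by
      intro y
      rw [← hG.inner_left_eq_inner_right]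
      exact (Submodule.mem_orthogonal _ _).mp hx _ ⟨y, rfl⟩
    exact hinj (by rw [map_zero]; exact inner_self_eq_zero.mp (h1 (G x)))
  rw [← Submodule.topologicalClosure_eq_top_iff] at h
  have := Submodule.dense_iff_topologicalClosure_eq_top.mpr h
  exact this

/-- On the range of `G` the decay is `O(1/r)`, since `r (1 + rG)⁻¹ G y = y - (1 + rG)⁻¹ y`. That
range is dense and the inverses are contractions, so the limit holds everywhere. -/
theorem tendsto_inverse_one_add_smul {G : X →L[ℂ] X} (hG : G.IsPositive) (hG1 : ‖G‖ ≤ 1)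
    (hinj : Function.Injective G) (x : X) :
    Filter.Tendsto (fun r : ℝ => Ring.inverse (1 + (r : ℂ) • G) x) Filter.atTop (𝓝 0) := by
  rw [Metric.tendsto_nhds]
  intro ε hε
  obtain ⟨y, hy⟩ := Metric.denseRange_iff.mp (denseRange_of_isPositive hG hinj) x (ε / 2)
    (half_pos hε)
  filter_upwards [Filter.eventually_gt_atTop 0, Filter.eventually_gt_atTop (4 * ‖y‖ / ε)]
    with r hr hr2
  have hr0 : (r : ℂ) ≠ 0 := by exact_mod_cast hr.ne'
  set M := Ring.inverse (1 + (r : ℂ) • G) with hM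
  have hM1 : ‖M‖ ≤ 1 := norm_inverse_one_add_smul_le hG hG1 hr
  have hle : ∀ v, ‖M v‖ ≤ ‖v‖ := fun v => by
    simpa using M.le_of_opNorm_le hM1 v
  have h2 : M y + (r : ℂ) • M (G y) = y := by
    have := DFunLike.congr_fun
      (Ring.inverse_mul_cancel _ (isUnit_one_add_smul hG hG1 hr)) y
    rw [← hM] at this
    simpa using this
  have h3 : r * ‖M (G y)‖ ≤ 2 * ‖y‖ := by
    have h4 : (r : ℂ) • M (G y) = y - M y := eq_sub_of_add_eq' h2
    have h5 : ‖(r : ℂ) • M (G y)‖ = r * ‖M (G y)‖ := by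
      rw [norm_smul, Complex.norm_real, Real.norm_of_nonneg hr.le]
    rw [← h5, h4]
    linarith [norm_sub_le y (M y), hle y]
  have h6 : ‖M (G y)‖ < ε / 2 := by
    rw [div_lt_iff₀ hε] at hr2
    by_contra! h7
    nlinarith [mul_le_mul_of_nonneg_left h7 hr.le]
  rw [dist_zero_right]
  calc ‖M x‖ = ‖M (x - G y) + M (G y)‖ := by rw [← map_add, sub_add_cancel]
    _ ≤ ‖x - G y‖ + ‖M (G y)‖ := (norm_add_le _ _).trans (by gcongr; exact hle _)
    _ < ε / 2 + ε / 2 := add_lt_add (by rwa [← dist_eq_norm]) h6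
    _ = ε := add_halves ε

/-- Strong convergence becomes norm convergence after composition with a finite-rank operator, and
such operators approximate `K` while the inverses stay bounded by `1`. -/
theorem tendsto_inverse_mul_compact {G K : X →L[ℂ] X} (hG : G.IsPositive) (hG1 : ‖G‖ ≤ 1)
    (hinj : Function.Injective G) (hK : IsCompactOperator K) :
    Filter.Tendsto (fun r : ℝ => ‖Ring.inverse (1 + (r : ℂ) • G) * K‖) Filter.atTop (𝓝 0) := by
  rw [Metric.tendsto_nhds]
  intro ε hε
  obtain ⟨n, e, φ, hF⟩ := exists_finiteRank_approx hK (half_pos hε)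
  have h1 : Filter.Tendsto (fun r : ℝ => ∑ i, ‖φ i‖ * ‖Ring.inverse (1 + (r : ℂ) • G) (e i)‖)
      Filter.atTop (𝓝 0) := by
    have := tendsto_finsetSum Finset.univ fun i (_ : i ∈ Finset.univ) =>
      ((tendsto_inverse_one_add_smul hG hG1 hinj (e i)).norm.const_mul ‖φ i‖)
    simpa using this
  filter_upwards [Filter.eventually_gt_atTop 0, h1.eventually_lt_const (half_pos hε)]
    with r hr hr2
  set M := Ring.inverse (1 + (r : ℂ) • G) with hM
  have hM1 : ‖M‖ ≤ 1 := norm_inverse_one_add_smul_le hG hG1 hr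
  have h2 : M * K = M * (K - ∑ i, (φ i).smulRight (e i)) + ∑ i, (φ i).smulRight (M (e i)) := by
    ext x
    simp
  rw [dist_zero_right, norm_norm, h2]
  calc _ ≤ ‖M‖ * ‖K - ∑ i, (φ i).smulRight (e i)‖ + ∑ i, ‖φ i‖ * ‖M (e i)‖ := by
        refine (norm_add_le _ _).trans (add_le_add (norm_mul_le _ _) ?_)
        refine (norm_sum_le _ _).trans (Finset.sum_le_sum fun i _ => ?_)
        rw [ContinuousLinearMap.norm_smulRight_apply]
    _ ≤ 1 * ‖K - ∑ i, (φ i).smulRight (e i)‖ + ∑ i, ‖φ i‖ * ‖M (e i)‖ := by gcongr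
    _ < ε / 2 + ε / 2 := by rw [one_mul]; exact add_lt_add hF hr2
    _ = ε := add_halves ε

end PositiveOperator

/-! ### Spectrum of a relatively compact perturbation, abstractly -/

section RelativelyCompact

variable {X : Type*} [NormedAddCommGroup X] [InnerProductSpace ℂ X]

/-- The half-line of all `c x` with `x ≥ 0`. -/
def halfLine (c : ℂ) : Set ℂ := (fun x : ℝ => c * (x : ℂ)) '' Ici 0

theorem isPreconnected_compl_halfLine {c : ℂ} (hc : c ≠ 0) : IsPreconnected (halfLine c)ᶜ := by
  have h : (halfLine c)ᶜ = (fun w : ℂ => -(c * w)) '' slitPlane := by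
    ext z
    constructor
    · intro hz
      refine ⟨-(z / c), ?_, by field_simp⟩
      by_contra hs
      rw [mem_slitPlane_iff, not_or, not_lt, not_not, neg_re, neg_im, neg_nonpos, neg_eq_zero] at hs
      obtain ⟨hre, him⟩ := hs
      refine hz ⟨(z / c).re, hre, ?_⟩
      have h2 : (((z / c).re : ℝ) : ℂ) = z / c := Complex.ext (by simp) (by simp [him])
      simp only [h2]
      field_simp
    · rintro ⟨w, hw, rfl⟩ ⟨x, hx, hxw⟩
      have h2 : w = -(x : ℂ) := by
        have h3 : c * (x : ℂ) = c * (-w) := by rw [mul_neg]; exact hxw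
        rw [mul_left_cancel₀ hc h3, neg_neg]
      rw [h2, mem_slitPlane_iff] at hw
      have hx0 : (0 : ℝ) ≤ x := hx
      rcases hw with hw | hw
      · simp only [neg_re, ofReal_re] at hw
        linarith
      · simp at hw
  rw [h]
  exact starConvex_one_slitPlane.isPathConnected one_mem_slitPlane
    |>.isConnected.isPreconnected.image _ (by fun_prop)

/-- `(T - z) G` for the operator `T` with `T G = c (1 - G) + K`. -/
def shiftedFamily (c : ℂ) (G K : X →L[ℂ] X) (z : ℂ) : X →L[ℂ] X :=
  c • 1 - (c + z) • G + K

variable {T : X →ₗ.[ℂ] X} {c : ℂ} {G K : X →L[ℂ] X}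

theorem apply_sub_smul_eq_shiftedFamily
    (hT : ∀ f, ∃ h : G f ∈ T.domain, T ⟨G f, h⟩ = c • (f - G f) + K f) (z : ℂ) (f : X)
    (h : G f ∈ T.domain) : T ⟨G f, h⟩ - z • G f = shiftedFamily c G K z f := by
  obtain ⟨_, h2⟩ := hT f
  rw [h2]
  simp only [shiftedFamily, add_apply, sub_apply, smul_apply, one_apply_eq_self, smul_sub,
    add_smul]
  abel

theorem resolvent_apply (hT : ∀ f, ∃ h : G f ∈ T.domain, T ⟨G f, h⟩ = c • (f - G f) + K f)
    (hdom : ∀ u ∈ T.domain, ∃ f, G f = u) {z : ℂ} (hz : IsUnit (shiftedFamily c G K z))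
    (u : T.domain) : (G * Ring.inverse (shiftedFamily c G K z)) (T u - z • (u : X)) = u := by
  obtain ⟨u, hu⟩ := u
  obtain ⟨f, rfl⟩ := hdom u hu
  have h := DFunLike.congr_fun (Ring.inverse_mul_cancel _ hz) f
  rw [apply_sub_smul_eq_shiftedFamily hT]
  exact congrArg G h

/-- `G` is a bijection onto the domain of `T`, so `T - z` and `(T - z) G` are bijective together;
the bounded inverse theorem supplies continuity. -/
theorem mem_resolventSetOf_iff [CompleteSpace X]
    (hT : ∀ f, ∃ h : G f ∈ T.domain, T ⟨G f, h⟩ = c • (f - G f) + K f)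
    (hdom : ∀ u ∈ T.domain, ∃ f, G f = u) (hG : Function.Injective G) (z : ℂ) :
    z ∈ resolventSetOf T ↔ IsUnit (shiftedFamily c G K z) := by
  constructor
  · rintro ⟨R, hR1, hR2⟩
    rw [ContinuousLinearMap.isUnit_iff_bijective]
    constructor
    · rw [injective_iff_map_eq_zero]
      intro g hg
      obtain ⟨h, -⟩ := hT g
      have h1 := hR2 ⟨G g, h⟩
      rw [apply_sub_smul_eq_shiftedFamily hT, hg, map_zero] at h1
      exact hG (h1.symm.trans (map_zero G).symm)
    · intro f
      obtain ⟨h, hf⟩ := hR1 f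
      obtain ⟨g, hg⟩ := hdom _ h
      refine ⟨g, ?_⟩
      simp only [← hg] at hf
      rw [← apply_sub_smul_eq_shiftedFamily hT z g (hg ▸ h)]
      exact hf
  · intro hz
    refine ⟨G * Ring.inverse (shiftedFamily c G K z), fun f => ?_, resolvent_apply hT hdom hz⟩
    obtain ⟨h, -⟩ := hT (Ring.inverse (shiftedFamily c G K z) f)
    refine ⟨h, ?_⟩
    have h1 := apply_sub_smul_eq_shiftedFamily hT z _ h
    refine h1.trans ?_
    exact DFunLike.congr_fun (Ring.mul_inverse_cancel _ hz) f

/-- If `c / (c + z)` were some `t` in the interval `[0, 1]` containing the spectrum of `G`, then `z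
= c (1/t - 1)` would lie on the half-line. The point `z = -c` is separate, as the operator is then
`c`. -/
theorem isUnit_sub_smul_of_notMem_halfLine [CompleteSpace X] (hc : c ≠ 0)
    (hG : G.IsPositive) (hG1 : ‖G‖ ≤ 1) {z : ℂ} (hz : z ∉ halfLine c) :
    IsUnit (c • (1 : X →L[ℂ] X) - (c + z) • G) := by
  rcases eq_or_ne (c + z) 0 with h | h
  · rw [h, zero_smul, sub_zero]
    exact isUnit_one.smul (Units.mk0 c hc)
  · have h1 : c • (1 : X →L[ℂ] X) - (c + z) • G =
        (c + z) • ((c / (c + z)) • (1 : X →L[ℂ] X) - G) := by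
      rw [smul_sub, smul_smul, mul_div_cancel₀ _ h]
    rw [h1]
    refine IsUnit.smul (Units.mk0 (c + z) h) (isUnit_smul_one_sub hG hG1 fun t ht0 ht1 ht => hz ?_)
    have htc : (t : ℂ) ≠ 0 := by rw [← ht]; exact div_ne_zero hc h
    have ht' : t ≠ 0 := by exact_mod_cast htc
    have htpos : 0 < t := lt_of_le_of_ne ht0 ht'.symm
    refine ⟨1 / t - 1, ?_, ?_⟩
    · rw [mem_Ici, sub_nonneg, le_div_iff₀ htpos, one_mul]
      exact ht1
    · push_cast
      rw [div_eq_iff h] at ht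
      field_simp
      linear_combination ht

theorem exists_shiftedFamily_isUnit [CompleteSpace X] (hc : c ≠ 0)
    (hG : G.IsPositive) (hG1 : ‖G‖ ≤ 1) (hinj : Function.Injective G)
    (hK : IsCompactOperator K) : ∃ z ∉ halfLine c, IsUnit (shiftedFamily c G K z) := by
  obtain ⟨r, hr, hr2⟩ := ((Filter.eventually_gt_atTop (0 : ℝ)).and
    ((tendsto_inverse_mul_compact hG hG1 hinj hK).eventually_lt_const
      (norm_pos_iff.mpr hc))).exists
  -- Here `c + z = -c r`, so the family equals `c (1 + rG) + K`; factoring out `1 + rG` leaves a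
  -- Neumann series, as `‖(1 + rG)⁻¹ K‖ < ‖c‖`.
  refine ⟨-(c * (1 + r)), ?_, ?_⟩
  · rintro ⟨x, hx, hxr⟩
    have h1 : c * (x : ℂ) = c * (-(1 + r)) := by rw [mul_neg]; exact hxr
    have h2 : x = -(1 + r) := by exact_mod_cast mul_left_cancel₀ hc h1
    have hx0 : (0 : ℝ) ≤ x := hx
    linarith
  · have hN := isUnit_one_add_smul hG hG1 hr
    set N := 1 + (r : ℂ) • G with hNdef
    have h1 : shiftedFamily c G K (-(c * (1 + r))) =
        N * (c • (1 - -(c⁻¹ • (Ring.inverse N * K)))) := by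
      have h2 : c • (1 - -(c⁻¹ • (Ring.inverse N * K))) = c • 1 + Ring.inverse N * K := by
        rw [sub_neg_eq_add, smul_add, smul_smul, mul_inv_cancel₀ hc, one_smul]
      have h3 : N * (c • 1 + Ring.inverse N * K) = c • N + K := by
        rw [mul_add, Ring.mul_inverse_cancel_left _ _ hN, mul_smul_comm, mul_one]
      rw [h2, h3, shiftedFamily, hNdef, smul_add, smul_smul, sub_eq_add_neg, ← neg_smul]
      congr 3
      ring
    rw [h1]
    refine hN.mul (IsUnit.smul (Units.mk0 c hc) (isUnit_one_sub_of_norm_lt_one ?_))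
    rw [norm_neg, norm_smul, norm_inv, inv_mul_lt_iff₀ (norm_pos_iff.mpr hc), mul_one]
    exact hr2

/-- Subtracting `K` from an invertible `B(z)` would leave an injective compact perturbation of an
invertible operator, hence an invertible one. At `z = c x` it is a multiple of `t - G` with `t = 1 /
(1 + x)`, which is not invertible. -/
theorem halfLine_subset_spectrumOf [CompleteSpace X]
    (hT : ∀ f, ∃ h : G f ∈ T.domain, T ⟨G f, h⟩ = c • (f - G f) + K f)
    (hdom : ∀ u ∈ T.domain, ∃ f, G f = u) (hinj : Function.Injective G) (hc : c ≠ 0)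
    (hK : IsCompactOperator K)
    (hGt : ∀ t : ℝ, 0 < t → t ≤ 1 → Function.Injective ((t : ℂ) • (1 : X →L[ℂ] X) - G) ∧
      ¬ IsUnit ((t : ℂ) • (1 : X →L[ℂ] X) - G)) : halfLine c ⊆ spectrumOf T := by
  rintro _ ⟨x, hx, rfl⟩ hz
  rw [mem_resolventSetOf_iff hT hdom hinj] at hz
  have hx0 : (0 : ℝ) ≤ x := hx
  have hx1 : (0 : ℝ) < 1 + x := by linarith
  obtain ⟨h1, h2⟩ := hGt (1 + x)⁻¹ (inv_pos.mpr hx1) (inv_le_one_of_one_le₀ (by linarith))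
  have hcx : c * (1 + x) ≠ 0 := mul_ne_zero hc (by exact_mod_cast hx1.ne')
  have h3 : shiftedFamily c G K (c * x) + -K =
      (c * (1 + x)) • ((((1 + x)⁻¹ : ℝ) : ℂ) • (1 : X →L[ℂ] X) - G) := by
    rw [shiftedFamily, add_neg_cancel_right, smul_sub, smul_smul]
    congr 2
    · have : (1 + x : ℂ) ≠ 0 := by exact_mod_cast hx1.ne'
      push_cast
      field_simp
    · ring
  have h4 : IsUnit (shiftedFamily c G K (c * x) + -K) := by
    refine isUnit_of_injective_add_compact hz hK.neg ?_
    rw [h3]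
    exact fun a b hab => h1 (smul_right_injective X hcx hab)
  rw [h3] at h4
  have h5 := h4.smul (Units.mk0 _ (inv_ne_zero hcx))
  rw [Units.smul_mk0, smul_smul, inv_mul_cancel₀ hcx, one_smul] at h5
  exact h2 h5

theorem halfLine_disjoint_discreteSpectrum (hc : c ≠ 0) (h : halfLine c ⊆ spectrumOf T) :
    Disjoint (halfLine c) (discreteSpectrum T) := by
  rw [Set.disjoint_left]
  rintro _ ⟨x, hx, rfl⟩ ⟨-, ⟨ε, hε, hball⟩, -⟩
  have hx0 : (0 : ℝ) ≤ x := hx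
  have hc0 : 0 < ‖c‖ := norm_pos_iff.mpr hc
  -- A second spectral point on the half-line, at distance `ε / 2`, contradicts isolation.
  have h1 : c * ((x + ε / (2 * ‖c‖) : ℝ) : ℂ) ∈ Metric.ball (c * (x : ℂ)) ε ∩ spectrumOf T := by
    refine ⟨?_, h ⟨_, ?_, rfl⟩⟩
    · rw [Metric.mem_ball, dist_eq_norm, ← mul_sub, ← ofReal_sub, add_sub_cancel_left, norm_mul,
        Complex.norm_real, Real.norm_of_nonneg (by positivity)]
      field_simp
      norm_num
    · rw [mem_Ici]
      positivity
  rw [hball, mem_singleton_iff] at h1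
  have h2 : x + ε / (2 * ‖c‖) = x := by exact_mod_cast mul_left_cancel₀ hc h1
  have h3 : 0 < ε / (2 * ‖c‖) := by positivity
  linarith

theorem mem_discreteSpectrum_of_notMem_halfLine [CompleteSpace X]
    (hT : ∀ f, ∃ h : G f ∈ T.domain, T ⟨G f, h⟩ = c • (f - G f) + K f)
    (hdom : ∀ u ∈ T.domain, ∃ f, G f = u) (hinj : Function.Injective G) (hc : c ≠ 0)
    (hG : G.IsPositive) (hG1 : ‖G‖ ≤ 1) (hK : IsCompactOperator K) {z : ℂ}
    (hz : z ∈ spectrumOf T) (hzc : z ∉ halfLine c) : z ∈ discreteSpectrum T := by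
  have hspec : ∀ w, w ∈ spectrumOf T ↔ ¬ IsUnit (shiftedFamily c G K w) := fun w =>
    not_congr (mem_resolventSetOf_iff hT hdom hinj w)
  have hDu := isUnit_sub_smul_of_notMem_halfLine hc hG hG1 hzc
  have hBan : AnalyticOnNhd ℂ (shiftedFamily c G K) (halfLine c)ᶜ := by
    intro w _
    unfold shiftedFamily
    exact (analyticAt_const.sub ((analyticAt_const.add analyticAt_id).smul
      analyticAt_const)).add analyticAt_const
  obtain ⟨z₀, hz₀, hz₀u⟩ := exists_shiftedFamily_isUnit hc hG hG1 hinj hK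
  obtain ⟨n, C, hC⟩ := analytic_fredholm (isPreconnected_compl_halfLine hc) hBan
    (fun w hw => ⟨_, K, isUnit_sub_smul_of_notMem_halfLine hc hG hG1 hw, hK, rfl⟩)
    hz₀ hz₀u hzc
  have hnu := (hspec z).mp hz
  refine ⟨?_, ?_, ?_⟩
  · have hni : ¬ Function.Injective (shiftedFamily c G K z) := fun h =>
      hnu (isUnit_of_injective_add_compact hDu hK h)
    rw [injective_iff_map_eq_zero] at hni
    push Not at hni
    obtain ⟨f, hf, hf0⟩ := hni
    obtain ⟨h, -⟩ := hT f
    refine ⟨⟨G f, h⟩, fun h0 => hf0 (hinj (by rw [map_zero]; exact h0)), ?_⟩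
    rw [← sub_eq_zero, apply_sub_smul_eq_shiftedFamily hT, hf]
  · rw [eventually_nhdsWithin_iff, Metric.eventually_nhds_iff] at hC
    obtain ⟨ε, hε, h⟩ := hC
    refine ⟨ε, hε, Set.eq_singleton_iff_unique_mem.mpr ⟨⟨Metric.mem_ball_self hε, hz⟩, ?_⟩⟩
    rintro w ⟨hw, hws⟩
    by_contra hwz
    exact (hspec w).mp hws (h hw hwz).1
  · have hkerB := (local_analytic_fredholm (hBan z hzc) hDu hK rfl).2
    -- The kernel of `T - z` is contained in the image under `G` of the finite-dimensional kernel of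
    -- `B(z)`.
    have hker : FiniteDimensional ℂ (LinearMap.ker (T.toFun - z • T.domain.subtype)) := by
      have h1 := Module.Finite.map
        (LinearMap.ker (shiftedFamily c G K z : X →ₗ[ℂ] X)) (G : X →ₗ[ℂ] X)
      refine Module.Finite.of_injective (LinearMap.codRestrict
        ((LinearMap.ker (shiftedFamily c G K z : X →ₗ[ℂ] X)).map (G : X →ₗ[ℂ] X))
        (T.domain.subtype.comp
          (LinearMap.ker (T.toFun - z • T.domain.subtype)).subtype) ?_) ?_
      · rintro ⟨⟨u, hu⟩, hu0⟩
        obtain ⟨f, rfl⟩ := hdom u hu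
        refine ⟨f, ?_, rfl⟩
        have h2 := apply_sub_smul_eq_shiftedFamily hT z f hu
        have h3 : T ⟨G f, hu⟩ - z • G f = 0 := hu0
        exact h2.symm.trans h3
      · intro a b hab
        have h4 := congrArg (fun w => w.1) hab
        exact Subtype.ext (Subtype.ext h4)
    refine algMult_lt_top_of_pole hker
      (R := fun w => G * Ring.inverse (shiftedFamily c G K w))
      (hC.mono fun w hw => resolvent_apply hT hdom hw.1) (n := n) (C := ‖G‖ * C) ?_
    filter_upwards [hC] with w hw
    rw [← mul_smul_comm]
    exact (norm_mul_le _ _).trans (by gcongr; exact hw.2)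

/-- Spectrum of a relatively compact perturbation `T` of a multiple of `G⁻¹ - 1`, for a positive
contraction `G` with purely continuous spectrum `[0, 1]`. -/
theorem essentialSpectrum_eq_halfLine [CompleteSpace X]
    (hT : ∀ f, ∃ h : G f ∈ T.domain, T ⟨G f, h⟩ = c • (f - G f) + K f)
    (hdom : ∀ u ∈ T.domain, ∃ f, G f = u) (hinj : Function.Injective G) (hc : c ≠ 0)
    (hG : G.IsPositive) (hG1 : ‖G‖ ≤ 1) (hK : IsCompactOperator K)
    (hGt : ∀ t : ℝ, 0 < t → t ≤ 1 → Function.Injective ((t : ℂ) • (1 : X →L[ℂ] X) - G) ∧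
      ¬ IsUnit ((t : ℂ) • (1 : X →L[ℂ] X) - G)) :
    essentialSpectrum T = halfLine c ∧ spectrumOf T \ halfLine c = discreteSpectrum T := by
  have h1 := halfLine_subset_spectrumOf hT hdom hinj hc hK hGt
  have h2 := Set.disjoint_left.mp (halfLine_disjoint_discreteSpectrum hc h1)
  have h3 : ∀ z ∈ spectrumOf T, z ∉ halfLine c → z ∈ discreteSpectrum T := fun z hz hzc =>
    mem_discreteSpectrum_of_notMem_halfLine hT hdom hinj hc hG hG1 hK hz hzc
  have h4 : discreteSpectrum T ⊆ spectrumOf T := by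
    rintro z ⟨-, ⟨ε, -, hball⟩, -⟩
    exact (hball.symm.subset (mem_singleton z)).2
  constructor
  · ext z
    exact ⟨fun hz => by_contra fun hzc => hz.2 (h3 z hz.1 hzc), fun hz => ⟨h1 hz, h2 hz⟩⟩
  · ext z
    exact ⟨fun hz => h3 z hz.1 hz.2, fun hz => ⟨h4 hz, fun hzc => h2 hzc hz⟩⟩

end RelativelyCompact

/-! ### The free resolvent as a Fourier multiplier -/

open scoped FourierTransform

/-- The symbol `4 π² |ξ|²` of `-Δ`. -/
noncomputable def freeSymbol (d : ℕ) (ξ : Rd d) : ℝ := (2 * Real.pi) ^ 2 * ‖ξ‖ ^ 2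

theorem freeSymbol_nonneg (d : ℕ) (ξ : Rd d) : 0 ≤ freeSymbol d ξ := by
  unfold freeSymbol; positivity

/-- The symbol of `(1 - Δ)⁻¹`. -/
noncomputable def resolventSymbol (d : ℕ) (ξ : Rd d) : ℂ := ((1 + freeSymbol d ξ)⁻¹ : ℝ)

theorem hasTemperateGrowth_freeSymbol (d : ℕ) :
    (fun ξ => (freeSymbol d ξ : ℂ)).HasTemperateGrowth := by
  unfold freeSymbol
  fun_prop

theorem hasTemperateGrowth_resolventSymbol (d : ℕ) :
    (resolventSymbol d).HasTemperateGrowth := by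
  have h : resolventSymbol d =
      fun ξ =>
        (((1 + ‖((2 * Real.pi) • ContinuousLinearMap.id ℝ (Rd d)) ξ‖ ^ 2) ^ (-1 : ℝ) : ℝ) : ℂ) := by
    ext ξ
    rw [resolventSymbol, freeSymbol, Real.rpow_neg_one]
    simp [norm_smul, mul_pow]
  rw [h]
  have h1 := Function.hasTemperateGrowth_one_add_norm_sq_rpow (Rd d) (-1)
  have h2 : Function.HasTemperateGrowth ((2 * Real.pi) • ContinuousLinearMap.id ℝ (Rd d)) := by fun_prop
  exact (Function.HasTemperateGrowth.comp (Complex.ofRealCLM.hasTemperateGrowth) (h1.comp h2))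

/-- Multiplication by a bounded function. -/
noncomputable def bddMul {d : ℕ} (m : Rd d → ℂ) (hm : MemLp m ∞ volume) : L2 d →L[ℂ] L2 d :=
  (ContinuousLinearMap.mul ℂ ℂ).holderL volume ∞ 2 2 (hm.toLp m)

theorem coeFn_bddMul {d : ℕ} {m : Rd d → ℂ} (hm : MemLp m ∞ volume) (f : L2 d) :
    bddMul m hm f =ᵐ[volume] fun x => m x * f x := by
  filter_upwards [(ContinuousLinearMap.mul ℂ ℂ).coeFn_holder (r := 2) (hm.toLp m) f, hm.coeFn_toLp]
    with x h1 h2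
  rw [← h2]
  exact h1

theorem bddMul_toTempered {d : ℕ} {m : Rd d → ℂ} (hm : MemLp m ∞ volume)
    (hm2 : m.HasTemperateGrowth) (f : L2 d) :
    (bddMul m hm f : 𝓢'(Rd d, ℂ)) = TemperedDistribution.smulLeftCLM ℂ m (f : 𝓢'(Rd d, ℂ)) := by
  rw [← Lp.toTemperedDistribution_smul_eq (r := 2) hm2 hm]
  rfl

theorem norm_resolventSymbol_le_one (d : ℕ) (ξ : Rd d) : ‖resolventSymbol d ξ‖ ≤ 1 := by
  have h := freeSymbol_nonneg d ξ
  rw [resolventSymbol, Complex.norm_real, Real.norm_of_nonneg (by positivity)]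
  exact inv_le_one_of_one_le₀ (by linarith)

theorem memLp_top_resolventSymbol (d : ℕ) : MemLp (resolventSymbol d) ∞ volume :=
  memLp_top_of_bound (hasTemperateGrowth_resolventSymbol d).1.continuous.aestronglyMeasurable 1
    (Filter.Eventually.of_forall (norm_resolventSymbol_le_one d))

/-- The Fourier multiplier with a bounded symbol, as a bounded operator. -/
noncomputable def fourierMul {d : ℕ} (m : Rd d → ℂ) (hm : MemLp m ∞ volume) : L2 d →L[ℂ] L2 d :=
  ((Lp.fourierTransformₗᵢ (Rd d) ℂ).symm : L2 d →L[ℂ] L2 d).comp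
    ((bddMul m hm).comp (Lp.fourierTransformₗᵢ (Rd d) ℂ : L2 d →L[ℂ] L2 d))

theorem fourier_fourierMul {d : ℕ} {m : Rd d → ℂ} (hm : MemLp m ∞ volume) (f : L2 d) :
    Lp.fourierTransformₗᵢ (Rd d) ℂ (fourierMul m hm f) =
      bddMul m hm (Lp.fourierTransformₗᵢ (Rd d) ℂ f) :=
  (Lp.fourierTransformₗᵢ (Rd d) ℂ).apply_symm_apply _

theorem fourier_toTempered {d : ℕ} (f : L2 d) :
    𝓕 (f : 𝓢'(Rd d, ℂ)) = (Lp.fourierTransformₗᵢ (Rd d) ℂ f : L2 d) :=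
  Lp.fourier_toTemperedDistribution_eq f

/-- The resolvent `(1 - Δ)⁻¹`. -/
noncomputable def freeResolvent (d : ℕ) : L2 d →L[ℂ] L2 d :=
  fourierMul (resolventSymbol d) (memLp_top_resolventSymbol d)

theorem fourier_neg_laplacian {d : ℕ} (u : 𝓢'(Rd d, ℂ)) :
    𝓕 (-Δ u) = TemperedDistribution.smulLeftCLM ℂ (fun ξ => (freeSymbol d ξ : ℂ)) (𝓕 u) := by
  have h : (fun ξ : Rd d => (freeSymbol d ξ : ℂ)) =
      (((2 * Real.pi) ^ 2 : ℝ) : ℂ) • fun ξ : Rd d => ((‖ξ‖ ^ 2 : ℝ) : ℂ) := by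
    ext ξ
    simp [freeSymbol]
  rw [h, TemperedDistribution.smulLeftCLM_smul (by fun_prop),
    TemperedDistribution.laplacian_eq_fourierMultiplierCLM, neg_smul, neg_neg,
    TemperedDistribution.fourierMultiplierCLM_apply, ← Complex.coe_smul,
    FourierTransform.fourier_smul, FourierTransform.fourier_fourierInv_eq]
  rfl

theorem toTempered_add {d : ℕ} (u v : L2 d) :
    ((u + v : L2 d) : 𝓢'(Rd d, ℂ)) = (u : 𝓢'(Rd d, ℂ)) + v := by
  simp only [← Lp.toTemperedDistributionCLM_apply, map_add]

theorem toTempered_sub {d : ℕ} (u v : L2 d) :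
    ((u - v : L2 d) : 𝓢'(Rd d, ℂ)) = (u : 𝓢'(Rd d, ℂ)) - v := by
  simp only [← Lp.toTemperedDistributionCLM_apply, map_sub]

theorem resolventSymbol_mul (d : ℕ) :
    resolventSymbol d * ((fun ξ => (freeSymbol d ξ : ℂ)) + fun _ => 1) = fun _ => 1 := by
  ext ξ
  have h := freeSymbol_nonneg d ξ
  have h2 : ((1 : ℂ) + freeSymbol d ξ) ≠ 0 := by exact_mod_cast (by positivity)
  simp only [Pi.mul_apply, Pi.add_apply, resolventSymbol]
  push_cast
  rw [add_comm (freeSymbol d ξ : ℂ) 1, inv_mul_cancel₀ h2]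

theorem freeResolvent_freeOp (d : ℕ) (u : (freeOp d).domain) :
    freeResolvent d (freeOp d u + (u : L2 d)) = u := by
  apply (Lp.fourierTransformₗᵢ (Rd d) ℂ).injective
  apply toTempered_injective
  have hu : ((freeOp d u : L2 d) : 𝓢'(Rd d, ℂ)) = -Δ ((u : L2 d) : 𝓢'(Rd d, ℂ)) :=
    negLaplacian_spec d u
  rw [freeResolvent, fourier_fourierMul,
    bddMul_toTempered _ (hasTemperateGrowth_resolventSymbol d), ← fourier_toTempered,
    ← fourier_toTempered, toTempered_add, hu, FourierTransform.fourier_add,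
    fourier_neg_laplacian]
  have h1 := TemperedDistribution.smulLeftCLM_const (F := ℂ) 1 (𝓕 ((u : L2 d) : 𝓢'(Rd d, ℂ)))
  rw [one_smul] at h1
  nth_rewrite 2 [← h1]
  rw [← add_apply, ← TemperedDistribution.smulLeftCLM_add (hasTemperateGrowth_freeSymbol d)
    (Function.HasTemperateGrowth.const 1), TemperedDistribution.smulLeftCLM_smulLeftCLM_apply
    ((hasTemperateGrowth_freeSymbol d).add (Function.HasTemperateGrowth.const 1))
    (hasTemperateGrowth_resolventSymbol d),
    mul_comm, resolventSymbol_mul, h1]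

theorem freeOp_freeResolvent (d : ℕ) (f : L2 d) :
    ∃ h : freeResolvent d f ∈ (freeOp d).domain,
      freeOp d ⟨freeResolvent d f, h⟩ = f - freeResolvent d f := by
  have hF : 𝓕 ((freeResolvent d f : L2 d) : 𝓢'(Rd d, ℂ)) =
      TemperedDistribution.smulLeftCLM ℂ (resolventSymbol d) (𝓕 (f : 𝓢'(Rd d, ℂ))) := by
    rw [fourier_toTempered, freeResolvent, fourier_fourierMul,
      bddMul_toTempered _ (hasTemperateGrowth_resolventSymbol d), ← fourier_toTempered]
  have hmem : freeResolvent d f ∈ (freeOp d).domain := by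
    change TemperedDistribution.MemSobolev 2 2 ((freeResolvent d f : L2 d) : 𝓢'(Rd d, ℂ))
    rw [TemperedDistribution.memSobolev_iff_exists_smulLeftCLM_fourier, hF]
    have hg : (fun ξ : Rd d => (((1 + ‖ξ‖ ^ 2) ^ ((2 : ℝ) / 2) : ℝ) : ℂ)).HasTemperateGrowth := by
      fun_prop
    rw [TemperedDistribution.smulLeftCLM_smulLeftCLM_apply
      (hasTemperateGrowth_resolventSymbol d) hg]
    have hg2 := (hasTemperateGrowth_resolventSymbol d).mul hg
    have hm : MemLp (resolventSymbol d *
        fun ξ : Rd d => (((1 + ‖ξ‖ ^ 2) ^ ((2 : ℝ) / 2) : ℝ) : ℂ)) ∞ volume := by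
      refine memLp_top_of_bound hg2.1.continuous.aestronglyMeasurable 1
        (Filter.Eventually.of_forall fun ξ => ?_)
      have h0 := freeSymbol_nonneg d ξ
      rw [Pi.mul_apply, resolventSymbol, ← ofReal_mul, Complex.norm_real,
        Real.norm_of_nonneg (by positivity), div_self two_ne_zero, Real.rpow_one,
        inv_mul_le_iff₀ (by positivity), mul_one, freeSymbol]
      -- This makes the Sobolev weight `1 + ‖ξ‖²` at most `1 + 4π²‖ξ‖²`, whence the bound `1`.
      have hpi : 1 ≤ (2 * Real.pi) ^ 2 := by nlinarith [Real.pi_gt_three]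
      nlinarith [sq_nonneg ‖ξ‖]
    exact ⟨bddMul _ hm (Lp.fourierTransformₗᵢ (Rd d) ℂ f), by
      rw [bddMul_toTempered _ hg2, fourier_toTempered]⟩
  refine ⟨hmem, ?_⟩
  apply (Lp.fourierTransformₗᵢ (Rd d) ℂ).injective
  apply toTempered_injective
  have hu : ((freeOp d ⟨freeResolvent d f, hmem⟩ : L2 d) : 𝓢'(Rd d, ℂ)) =
      -Δ ((freeResolvent d f : L2 d) : 𝓢'(Rd d, ℂ)) := negLaplacian_spec d ⟨_, hmem⟩
  rw [map_sub, toTempered_sub, ← fourier_toTempered, ← fourier_toTempered, ← fourier_toTempered,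
    hu, fourier_neg_laplacian, hF, TemperedDistribution.smulLeftCLM_smulLeftCLM_apply
    (hasTemperateGrowth_resolventSymbol d) (hasTemperateGrowth_freeSymbol d), eq_sub_iff_add_eq,
    ← add_apply, ← TemperedDistribution.smulLeftCLM_add
      ((hasTemperateGrowth_resolventSymbol d).mul (hasTemperateGrowth_freeSymbol d))
      (hasTemperateGrowth_resolventSymbol d)]
  have h1 : resolventSymbol d * (fun ξ => (freeSymbol d ξ : ℂ)) + resolventSymbol d =
      fun _ => 1 := by
    rw [← resolventSymbol_mul d, mul_add]
    congr 1
    ext ξ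
    simp
  rw [h1, TemperedDistribution.smulLeftCLM_const, one_smul]

theorem freeResolvent_injective (d : ℕ) : Function.Injective (freeResolvent d) := by
  rw [injective_iff_map_eq_zero]
  intro f hf
  obtain ⟨h, hf2⟩ := freeOp_freeResolvent d f
  have h0 : (⟨freeResolvent d f, h⟩ : (freeOp d).domain) = 0 := Subtype.ext hf
  rw [h0, hf, sub_zero, LinearPMap.map_zero] at hf2
  exact hf2.symm

theorem isProdFreeResolvent_iff {d : ℕ} {B : L2 d →ₗ.[ℂ] L2 d} {K : L2 d →L[ℂ] L2 d} :
    IsProdFreeResolvent d B K ↔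
      ∀ f, ∃ h : freeResolvent d f ∈ B.domain, B ⟨freeResolvent d f, h⟩ = K f := by
  constructor
  · intro hB f
    obtain ⟨h, hf⟩ := freeOp_freeResolvent d f
    obtain ⟨h1, h2⟩ := hB ⟨_, h⟩
    rw [hf, sub_add_cancel] at h2
    exact ⟨h1, h2.symm⟩
  · intro hB u
    obtain ⟨h1, h2⟩ := hB (freeOp d u + (u : L2 d))
    have h3 := freeResolvent_freeOp d u
    refine ⟨h3 ▸ h1, ?_⟩
    rw [← h2]
    congr 1
    exact Subtype.ext h3

theorem norm_bddMul_le {d : ℕ} {m : Rd d → ℂ} (hm : MemLp m ∞ volume) {C : ℝ}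
    (hC : ∀ x, ‖m x‖ ≤ C) (f : L2 d) : ‖bddMul m hm f‖ ≤ C * ‖f‖ := by
  refine Lp.norm_le_mul_norm_of_ae_le_mul ?_
  filter_upwards [coeFn_bddMul hm f] with x hx
  rw [hx, norm_mul]
  gcongr
  exact hC x

theorem norm_freeResolvent_le (d : ℕ) : ‖freeResolvent d‖ ≤ 1 := by
  refine ContinuousLinearMap.opNorm_le_bound _ zero_le_one fun f => ?_
  rw [← (Lp.fourierTransformₗᵢ (Rd d) ℂ).norm_map, freeResolvent, fourier_fourierMul,
    ← (Lp.fourierTransformₗᵢ (Rd d) ℂ).norm_map f]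
  exact norm_bddMul_le _ (norm_resolventSymbol_le_one d) _

theorem freeResolvent_isPositive (d : ℕ) : (freeResolvent d).IsPositive := by
  have hG : ∀ f, Lp.fourierTransformₗᵢ (Rd d) ℂ (freeResolvent d f) =
      bddMul (resolventSymbol d) (memLp_top_resolventSymbol d)
        (Lp.fourierTransformₗᵢ (Rd d) ℂ f) := fun f => fourier_fourierMul _ f
  constructor
  · intro f g
    change inner ℂ (freeResolvent d f) g = inner ℂ f (freeResolvent d g)
    rw [← (Lp.fourierTransformₗᵢ (Rd d) ℂ).inner_map_map, hG,
      ← (Lp.fourierTransformₗᵢ (Rd d) ℂ).inner_map_map f, hG, L2.inner_def, L2.inner_def]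
    refine integral_congr_ae ?_
    filter_upwards [coeFn_bddMul (memLp_top_resolventSymbol d) (Lp.fourierTransformₗᵢ (Rd d) ℂ f),
      coeFn_bddMul (memLp_top_resolventSymbol d) (Lp.fourierTransformₗᵢ (Rd d) ℂ g)] with x h1 h2
    rw [h1, h2, ← smul_eq_mul, ← smul_eq_mul, inner_smul_left, inner_smul_right, resolventSymbol,
      conj_ofReal]
  · intro f
    change 0 ≤ RCLike.re (inner ℂ (freeResolvent d f) f)
    rw [← (Lp.fourierTransformₗᵢ (Rd d) ℂ).inner_map_map, hG, L2.inner_def]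
    have h : ∀ᵐ x ∂(volume : Measure (Rd d)),
        inner ℂ (bddMul (resolventSymbol d) (memLp_top_resolventSymbol d)
          (Lp.fourierTransformₗᵢ (Rd d) ℂ f) x) (Lp.fourierTransformₗᵢ (Rd d) ℂ f x) =
        (((1 + freeSymbol d x)⁻¹ * ‖Lp.fourierTransformₗᵢ (Rd d) ℂ f x‖ ^ 2 : ℝ) : ℂ) := by
      filter_upwards [coeFn_bddMul (memLp_top_resolventSymbol d)
        (Lp.fourierTransformₗᵢ (Rd d) ℂ f)] with x h1
      rw [h1, ← smul_eq_mul, inner_smul_left, resolventSymbol, conj_ofReal,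
        inner_self_eq_norm_sq_to_K]
      push_cast
      rfl
    rw [integral_congr_ae h, integral_complex_ofReal]
    refine integral_nonneg fun x => ?_
    have := freeSymbol_nonneg d x
    positivity

/-- The Fourier transform of an eigenfunction would live on a level set of the symbol, which lies in
a sphere and is null because `d ≥ 1`. -/
theorem injective_smul_one_sub_freeResolvent {d : ℕ} (hd : 1 ≤ d) (t : ℝ) :
    Function.Injective ((t : ℂ) • (1 : L2 d →L[ℂ] L2 d) - freeResolvent d) := by
  have : Nonempty (Fin d) := ⟨⟨0, hd⟩⟩
  rw [injective_iff_map_eq_zero]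
  intro f hf
  have h1 : freeResolvent d f = (t : ℂ) • f := by
    rw [sub_apply, sub_eq_zero] at hf
    exact hf.symm
  apply (Lp.fourierTransformₗᵢ (Rd d) ℂ).injective
  rw [map_zero]
  set g := Lp.fourierTransformₗᵢ (Rd d) ℂ f with hg
  have h2 : bddMul (resolventSymbol d) (memLp_top_resolventSymbol d) g = (t : ℂ) • g := by
    rw [hg, ← fourier_fourierMul, ← map_smul]
    exact congrArg _ h1
  have hnull : volume (Metric.sphere (0 : Rd d) (√(t⁻¹ - 1) / (2 * Real.pi))) = 0 :=
    Measure.addHaar_sphere _ _ _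
  rw [Lp.eq_zero_iff_ae_eq_zero]
  filter_upwards [coeFn_bddMul (memLp_top_resolventSymbol d) g, Lp.coeFn_smul (t : ℂ) g,
    measure_eq_zero_iff_ae_notMem.mp hnull] with ξ h3 h4 h5
  by_contra h6
  refine h5 ?_
  rw [h2, h4, Pi.smul_apply, smul_eq_mul] at h3
  have h7 : t = (1 + freeSymbol d ξ)⁻¹ := ofReal_injective (mul_right_cancel₀ h6 h3)
  have h8 : t⁻¹ - 1 = (2 * Real.pi * ‖ξ‖) ^ 2 := by
    rw [h7, inv_inv, freeSymbol]
    ring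
  rw [mem_sphere_zero_iff_norm, h8, Real.sqrt_sq (by positivity)]
  field_simp

/-- Approximate eigenfunctions: the inverse Fourier transform of the indicator of a small open set
on which the symbol is within `ε` of `t`. An inverse `J` would need `1 ≤ ‖J‖ ε`, and `ε` is chosen
to prevent this. -/
theorem not_isUnit_smul_one_sub_freeResolvent {d : ℕ} (hd : 1 ≤ d) {t : ℝ} (ht0 : 0 < t)
    (ht1 : t ≤ 1) : ¬ IsUnit ((t : ℂ) • (1 : L2 d →L[ℂ] L2 d) - freeResolvent d) := by
  have : Nonempty (Fin d) := ⟨⟨0, hd⟩⟩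
  intro hu
  set J := Ring.inverse ((t : ℂ) • (1 : L2 d →L[ℂ] L2 d) - freeResolvent d) with hJ
  have hJ1 : ∀ f, J (((t : ℂ) • (1 : L2 d →L[ℂ] L2 d) - freeResolvent d) f) = f := fun f =>
    DFunLike.congr_fun (Ring.inverse_mul_cancel _ hu) f
  have hε : 0 < (2 * (‖J‖ + 1))⁻¹ := by positivity
  set ε := (2 * (‖J‖ + 1))⁻¹ with hεdef
  have ht2 : 0 ≤ t⁻¹ - 1 := sub_nonneg.mpr ((one_le_inv₀ ht0).mpr ht1)
  obtain ⟨ξ₀, hξ₀⟩ := exists_norm_eq (Rd d) (c := √(t⁻¹ - 1) / (2 * Real.pi)) (by positivity)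
  have hρ : resolventSymbol d ξ₀ = t := by
    rw [resolventSymbol, freeSymbol, hξ₀, ← mul_pow, mul_div_cancel₀ _ (by positivity),
      Real.sq_sqrt ht2, add_sub_cancel, inv_inv]
  let A : Set (Rd d) := {ξ | ‖(t : ℂ) - resolventSymbol d ξ‖ < ε} ∩ Metric.ball ξ₀ 1
  have hAo : IsOpen A := by
    refine IsOpen.inter (isOpen_lt ?_ continuous_const) Metric.isOpen_ball
    exact (continuous_const.sub (hasTemperateGrowth_resolventSymbol d).1.continuous).norm
  have hAne : A.Nonempty := ⟨ξ₀, by simp [hρ, hε], Metric.mem_ball_self one_pos⟩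
  have hA0 : volume A ≠ 0 := (hAo.measure_pos volume hAne).ne'
  have hAtop : volume A ≠ ⊤ :=
    ((measure_mono inter_subset_right).trans_lt measure_ball_lt_top).ne
  let g : L2 d := indicatorConstLp 2 hAo.measurableSet hAtop (1 : ℂ)
  have hg0 : 0 < ‖g‖ := by
    rw [norm_indicatorConstLp two_ne_zero ENNReal.ofNat_ne_top, norm_one, one_mul]
    exact Real.rpow_pos_of_pos (ENNReal.toReal_pos hA0 hAtop) _
  let f : L2 d := (Lp.fourierTransformₗᵢ (Rd d) ℂ).symm g
  have hUf : Lp.fourierTransformₗᵢ (Rd d) ℂ f = g :=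
    (Lp.fourierTransformₗᵢ (Rd d) ℂ).apply_symm_apply g
  have hf0 : ‖f‖ = ‖g‖ := by
    rw [← (Lp.fourierTransformₗᵢ (Rd d) ℂ).norm_map f, hUf]
  have h1 : ‖((t : ℂ) • (1 : L2 d →L[ℂ] L2 d) - freeResolvent d) f‖ ≤ ε * ‖g‖ := by
    rw [← (Lp.fourierTransformₗᵢ (Rd d) ℂ).norm_map, sub_apply, map_sub, smul_apply, map_smul,
      one_apply_eq_self, freeResolvent, fourier_fourierMul, hUf]
    refine Lp.norm_le_mul_norm_of_ae_le_mul ?_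
    filter_upwards [coeFn_bddMul (memLp_top_resolventSymbol d) g, Lp.coeFn_smul (t : ℂ) g,
      Lp.coeFn_sub ((t : ℂ) • g) (bddMul (resolventSymbol d) (memLp_top_resolventSymbol d) g),
      indicatorConstLp_coeFn (p := 2) (hs := hAo.measurableSet) (hμs := hAtop) (c := (1 : ℂ))]
      with ξ h2 h3 h4 h5
    rw [h4, Pi.sub_apply, h3, h2, Pi.smul_apply, smul_eq_mul, ← sub_mul, norm_mul]
    by_cases hξ : ξ ∈ A
    · gcongr
      exact hξ.1.le
    · have h6 : g ξ = 0 := by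
        rw [h5, indicator_of_notMem hξ]
      simp [h6]
  have h2 : ‖f‖ ≤ ‖J‖ * (ε * ‖g‖) := by
    conv_lhs => rw [← hJ1 f]
    exact (J.le_opNorm _).trans (by gcongr)
  have h3 : ‖J‖ * ε < 1 := by
    rw [hεdef, ← div_eq_mul_inv, div_lt_one (by positivity)]
    linarith [norm_nonneg J]
  rw [hf0, ← mul_assoc] at h2
  nlinarith

/-! ### Real dilations and transport of compactness -/

section Dilation

variable {d : ℕ}

theorem map_volume_smul {a : ℝ} (ha : a ≠ 0) :
    (volume : Measure (Rd d)).map (a • ·) =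
      ENNReal.ofReal |(a ^ Module.finrank ℝ (Rd d))⁻¹| • volume :=
  Measure.map_addHaar_smul _ ha

theorem quasiMeasurePreserving_smul {a : ℝ} (ha : a ≠ 0) :
    Measure.QuasiMeasurePreserving (fun x : Rd d => a • x) volume volume :=
  ⟨measurable_const_smul a, by
    rw [map_volume_smul ha]
    exact Measure.smul_absolutelyContinuous⟩

theorem eLpNorm_comp_smul {a : ℝ} (ha : a ≠ 0) {f : Rd d → ℂ}
    (hf : AEStronglyMeasurable f volume) :
    eLpNorm (fun x => f (a • x)) 2 volume =
      ENNReal.ofReal |(a ^ Module.finrank ℝ (Rd d))⁻¹| ^ (1 / (2 : ℝ≥0∞)).toReal •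
        eLpNorm f 2 volume := by
  have h0 : ENNReal.ofReal |(a ^ Module.finrank ℝ (Rd d))⁻¹| ≠ 0 := by
    rw [ne_eq, ENNReal.ofReal_eq_zero, not_le, abs_pos]
    positivity
  have h1 : AEStronglyMeasurable f ((volume : Measure (Rd d)).map (a • ·)) :=
    hf.mono_ac (quasiMeasurePreserving_smul ha).absolutelyContinuous
  have h2 := eLpNorm_map_measure (p := 2) h1 (measurable_const_smul a).aemeasurable
  rw [map_volume_smul ha, eLpNorm_smul_measure_of_ne_zero h0] at h2
  exact h2.symm

theorem memLp_comp_smul {a : ℝ} (ha : a ≠ 0) {f : Rd d → ℂ} (hf : MemLp f 2 volume) :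
    MemLp (fun x => f (a • x)) 2 volume := by
  refine ⟨hf.1.comp_quasiMeasurePreserving (quasiMeasurePreserving_smul ha), ?_⟩
  rw [eLpNorm_comp_smul ha hf.1, smul_eq_mul]
  refine ENNReal.mul_lt_top (ENNReal.rpow_lt_top_of_nonneg (by simp) ENNReal.ofReal_ne_top) hf.2

/-- The dilation `f ↦ f (a ·)` of square integrable functions. -/
noncomputable def dilateL2 (d : ℕ) {a : ℝ} (ha : a ≠ 0) : L2 d →L[ℂ] L2 d :=
  LinearMap.mkContinuous
    { toFun := fun f => (memLp_comp_smul ha (Lp.memLp f)).toLp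
      map_add' := fun f g => by
        rw [← MemLp.toLp_add, MemLp.toLp_eq_toLp_iff]
        exact (quasiMeasurePreserving_smul ha).ae_eq (Lp.coeFn_add f g)
      map_smul' := fun c f => by
        rw [RingHom.id_apply, ← MemLp.toLp_const_smul, MemLp.toLp_eq_toLp_iff]
        exact (quasiMeasurePreserving_smul ha).ae_eq (Lp.coeFn_smul c f) }
    (ENNReal.ofReal |(a ^ Module.finrank ℝ (Rd d))⁻¹| ^ (1 / (2 : ℝ≥0∞)).toReal).toReal
    fun f => by
      change ‖(memLp_comp_smul ha (Lp.memLp f)).toLp‖ ≤ _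
      rw [Lp.norm_toLp, eLpNorm_comp_smul ha (Lp.memLp f).1, smul_eq_mul, ENNReal.toReal_mul,
        Lp.norm_def]

theorem coeFn_dilateL2 {a : ℝ} (ha : a ≠ 0) (f : L2 d) :
    dilateL2 d ha f =ᵐ[volume] fun x => f (a • x) :=
  (memLp_comp_smul ha (Lp.memLp f)).coeFn_toLp

theorem dilateL2_inv_apply {a : ℝ} (ha : a ≠ 0) (f : L2 d) :
    dilateL2 d ha (dilateL2 d (inv_ne_zero ha) f) = f := by
  apply Lp.ext
  filter_upwards [coeFn_dilateL2 ha (dilateL2 d (inv_ne_zero ha) f),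
    (quasiMeasurePreserving_smul ha).ae (coeFn_dilateL2 (inv_ne_zero ha) f)] with x h1 h2
  rw [h1, h2, smul_smul, inv_mul_cancel₀ ha, one_smul]

/-- The dilation `x ↦ a x` as a continuous linear equivalence. -/
noncomputable def smulEquiv (d : ℕ) {a : ℝ} (ha : a ≠ 0) : Rd d ≃L[ℝ] Rd d :=
  ContinuousLinearEquiv.smulLeft (Units.mk0 a ha)

theorem smulEquiv_apply {a : ℝ} (ha : a ≠ 0) (x : Rd d) : smulEquiv d ha x = a • x := rfl

theorem fourier_comp_smul {a : ℝ} (ha : a ≠ 0) (φ : 𝓢(Rd d, ℂ)) (ξ : Rd d) :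
    𝓕 (SchwartzMap.compCLMOfContinuousLinearEquiv ℂ (smulEquiv d ha) φ) ξ =
      (|(a ^ Module.finrank ℝ (Rd d))⁻¹| : ℝ) • 𝓕 φ (a⁻¹ • ξ) := by
  rw [SchwartzMap.fourier_coe, SchwartzMap.fourier_coe, Real.fourier_eq, Real.fourier_eq,
    ← Measure.integral_comp_smul]
  refine integral_congr_ae (Filter.Eventually.of_forall fun x => ?_)
  simp only [SchwartzMap.compCLMOfContinuousLinearEquiv_apply, Function.comp_apply,
    smulEquiv_apply, inner_smul_left, inner_smul_right, conj_trivial]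
  rw [inv_mul_cancel_left₀ ha]

theorem dilateL2_toLp {a : ℝ} (ha : a ≠ 0) (φ : 𝓢(Rd d, ℂ)) :
    dilateL2 d ha (φ.toLp 2) =
      (SchwartzMap.compCLMOfContinuousLinearEquiv ℂ (smulEquiv d ha) φ).toLp 2 := by
  apply Lp.ext
  filter_upwards [coeFn_dilateL2 ha (φ.toLp 2),
    (quasiMeasurePreserving_smul ha).ae (SchwartzMap.coeFn_toLp φ 2 volume),
    SchwartzMap.coeFn_toLp
      (SchwartzMap.compCLMOfContinuousLinearEquiv ℂ (smulEquiv d ha) φ) 2 volume] with x h1 h2 h3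
  rw [h1, h2, h3]
  rfl

theorem fourier_dilateL2 {a : ℝ} (ha : a ≠ 0) (f : L2 d) :
    Lp.fourierTransformₗᵢ (Rd d) ℂ (dilateL2 d ha f) =
      ((|(a ^ Module.finrank ℝ (Rd d))⁻¹| : ℝ) : ℂ) •
        dilateL2 d (inv_ne_zero ha) (Lp.fourierTransformₗᵢ (Rd d) ℂ f) := by
  refine DenseRange.induction_on (p := fun f : L2 d => Lp.fourierTransformₗᵢ (Rd d) ℂ
    (dilateL2 d ha f) = ((|(a ^ Module.finrank ℝ (Rd d))⁻¹| : ℝ) : ℂ) •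
        dilateL2 d (inv_ne_zero ha) (Lp.fourierTransformₗᵢ (Rd d) ℂ f))
    (SchwartzMap.denseRange_toLpCLM (p := 2) ENNReal.ofNat_ne_top) f ?_ ?_
  · exact isClosed_eq
      ((Lp.fourierTransformₗᵢ (Rd d) ℂ).continuous.comp (dilateL2 d ha).continuous)
      (((|(a ^ Module.finrank ℝ (Rd d))⁻¹| : ℝ) : ℂ) • (dilateL2 d (inv_ne_zero ha)).comp
        (Lp.fourierTransformₗᵢ (Rd d) ℂ : L2 d →L[ℂ] L2 d)).continuous
  · intro φ
    have hU : ∀ ψ : 𝓢(Rd d, ℂ), Lp.fourierTransformₗᵢ (Rd d) ℂ (ψ.toLp 2) = (𝓕 ψ).toLp 2 :=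
      SchwartzMap.toLp_fourier_eq
    change Lp.fourierTransformₗᵢ (Rd d) ℂ (dilateL2 d ha (φ.toLp 2)) = _ •
        dilateL2 d (inv_ne_zero ha) (Lp.fourierTransformₗᵢ (Rd d) ℂ (φ.toLp 2))
    rw [dilateL2_toLp, hU, hU]
    apply Lp.ext
    filter_upwards [SchwartzMap.coeFn_toLp
        (𝓕 (SchwartzMap.compCLMOfContinuousLinearEquiv ℂ (smulEquiv d ha) φ)) 2 volume,
      Lp.coeFn_smul ((|(a ^ Module.finrank ℝ (Rd d))⁻¹| : ℝ) : ℂ)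
        (dilateL2 d (inv_ne_zero ha) ((𝓕 φ).toLp 2)),
      coeFn_dilateL2 (inv_ne_zero ha) ((𝓕 φ).toLp 2),
      (quasiMeasurePreserving_smul (inv_ne_zero ha)).ae
        (SchwartzMap.coeFn_toLp (𝓕 φ) 2 volume)] with ξ h1 h2 h3 h4
    rw [h1, h2, Pi.smul_apply, h3, h4, fourier_comp_smul, Complex.coe_smul]

/-- The symbol of `(1 - Δ) (1 - a⁻² Δ)⁻¹`. -/
noncomputable def ratioSymbol (d : ℕ) (a : ℝ) (ξ : Rd d) : ℂ :=
  (1 + (freeSymbol d ξ : ℂ)) * resolventSymbol d (a⁻¹ • ξ)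

theorem memLp_top_ratioSymbol {a : ℝ} (ha : a ≠ 0) : MemLp (ratioSymbol d a) ∞ volume := by
  refine memLp_top_of_bound (Continuous.aestronglyMeasurable ?_) (1 + a ^ 2)
    (Filter.Eventually.of_forall fun ξ => ?_)
  · exact (continuous_const.add (hasTemperateGrowth_freeSymbol d).1.continuous).mul
      ((hasTemperateGrowth_resolventSymbol d).1.continuous.comp (continuous_const_smul _))
  · have h1 := freeSymbol_nonneg d ξ
    have h3 : ratioSymbol d a ξ =
        (((1 + freeSymbol d ξ) * (1 + freeSymbol d (a⁻¹ • ξ))⁻¹ : ℝ) : ℂ) := by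
      rw [ratioSymbol, resolventSymbol]
      push_cast
      ring
    have h2 := freeSymbol_nonneg d (a⁻¹ • ξ)
    rw [h3, Complex.norm_real, Real.norm_of_nonneg (by positivity), mul_inv_le_iff₀ (by positivity)]
    -- With `s` the symbol at `a⁻¹ • ξ`, the ratio is `(1 + a² s) / (1 + s)`, hence at most `1 +
    -- a²`.
    have h4 : freeSymbol d ξ = a ^ 2 * freeSymbol d (a⁻¹ • ξ) := by
      have h5 : ‖a⁻¹ • ξ‖ ^ 2 = (a ^ 2)⁻¹ * ‖ξ‖ ^ 2 := by
        rw [norm_smul, mul_pow, norm_inv, inv_pow, Real.norm_eq_abs, sq_abs]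
      rw [freeSymbol, freeSymbol, h5]
      field_simp
    nlinarith [sq_nonneg a]

/-- Dilation preserves the range of the resolvent: commuting it past `(1 - Δ)⁻¹` costs only a
bounded Fourier multiplier. -/
theorem dilateL2_freeResolvent {a : ℝ} (ha : a ≠ 0) (f : L2 d) :
    dilateL2 d ha (freeResolvent d f) =
      freeResolvent d (fourierMul (ratioSymbol d a) (memLp_top_ratioSymbol ha)
        (dilateL2 d ha f)) := by
  apply (Lp.fourierTransformₗᵢ (Rd d) ℂ).injective
  rw [fourier_dilateL2, freeResolvent, fourier_fourierMul, fourier_fourierMul, fourier_fourierMul,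
    fourier_dilateL2, map_smul, map_smul]
  congr 1
  set g := Lp.fourierTransformₗᵢ (Rd d) ℂ f
  apply Lp.ext
  have ha' := inv_ne_zero ha
  filter_upwards [coeFn_dilateL2 ha' (bddMul _ (memLp_top_resolventSymbol d) g),
    (quasiMeasurePreserving_smul ha').ae (coeFn_bddMul (memLp_top_resolventSymbol d) g),
    coeFn_bddMul (memLp_top_resolventSymbol d)
      (bddMul _ (memLp_top_ratioSymbol ha) (dilateL2 d ha' g)),
    coeFn_bddMul (memLp_top_ratioSymbol ha) (dilateL2 d ha' g),
    coeFn_dilateL2 ha' g] with ξ h1 h2 h3 h4 h5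
  rw [h1, h2, h3, h4, h5, ratioSymbol, ← mul_assoc, ← mul_assoc]
  congr 1
  have h6 := congrFun (resolventSymbol_mul d) ξ
  simp only [Pi.mul_apply, Pi.add_apply] at h6
  rw [add_comm (1 : ℂ), h6, one_mul]

theorem isProdFreeResolvent_mulOp_iff {V : Rd d → ℂ} {K : L2 d →L[ℂ] L2 d} :
    IsProdFreeResolvent d (mulOp d V) K ↔
      ∀ f, K f =ᵐ[volume] fun x => V x * freeResolvent d f x := by
  rw [isProdFreeResolvent_iff]
  refine forall_congr' fun f => ⟨?_, fun h => ?_⟩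
  · rintro ⟨h, hK⟩
    rw [← hK]
    exact (memLp_mul d V ⟨_, h⟩).coeFn_toLp
  · have hmem : freeResolvent d f ∈ (mulOp d V).domain := (Lp.memLp (K f)).ae_eq h
    refine ⟨hmem, Lp.ext ?_⟩
    exact (memLp_mul d V ⟨_, hmem⟩).coeFn_toLp.trans h.symm

theorem isCompactOperator_of_dilate {V : Rd d → ℂ} {K₀ K : L2 d →L[ℂ] L2 d}
    (hK₀ : IsProdFreeResolvent d (mulOp d V) K₀) (hc : IsCompactOperator K₀) {t : ℝ}
    (hK : IsProdFreeResolvent d (mulOp d (dilate V t)) K) : IsCompactOperator K := by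
  rw [isProdFreeResolvent_mulOp_iff] at hK₀ hK
  have ha : Real.exp t ≠ 0 := (Real.exp_pos t).ne'
  have ha' := inv_ne_zero ha
  -- Chosen so that `G B = U⁻¹ G` for the dilation `U`; thus `U V G B = U V U⁻¹ G`, the dilated
  -- potential times `G`.
  let B : L2 d →L[ℂ] L2 d := (fourierMul (ratioSymbol d (Real.exp t)⁻¹)
    (memLp_top_ratioSymbol ha')).comp (dilateL2 d ha')
  have h : K = (dilateL2 d ha).comp (K₀.comp B) := by
    ext1 f
    apply Lp.ext
    have h1 : freeResolvent d (B f) = dilateL2 d ha' (freeResolvent d f) :=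
      (dilateL2_freeResolvent ha' f).symm
    have h2 : dilateL2 d ha (freeResolvent d (B f)) = freeResolvent d f := by
      rw [h1, dilateL2_inv_apply]
    have h3 := coeFn_dilateL2 ha (freeResolvent d (B f))
    rw [h2] at h3
    filter_upwards [hK f, coeFn_dilateL2 ha (K₀ (B f)),
      (quasiMeasurePreserving_smul ha).ae (hK₀ (B f)), h3] with x h4 h5 h6 h7
    rw [h4, ContinuousLinearMap.comp_apply, ContinuousLinearMap.comp_apply, h5, h6, h7]
    rfl
  rw [h]
  exact (hc.comp_clm B).clm_comp (dilateL2 d ha)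

end Dilation

/-! ### Analytic continuation from the real line to the strip -/

section Continuation

variable {d : ℕ} {α : ℝ}

theorem isPreconnected_strip (α : ℝ) : IsPreconnected (strip α) := by
  have h : strip α = Complex.im ⁻¹' Ioo (-α) α := by
    ext z
    exact abs_lt (a := z.im)
  rw [h]
  exact ((convex_Ioo (-α) α).linear_preimage Complex.imLm).isPreconnected

/-- An analytic function on the strip that vanishes on the real line vanishes. -/
theorem eq_zero_of_forall_real {E : Type*} [NormedAddCommGroup E] [NormedSpace ℂ E] (hα : 0 < α)
    {F : ℂ → E} (hF : AnalyticOnNhd ℂ F (strip α)) (h : ∀ t : ℝ, F t = 0) {θ : ℂ}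
    (hθ : θ ∈ strip α) : F θ = 0 := by
  have h0 : (0 : ℂ) ∈ strip α := by simpa [strip] using hα
  refine hF.eqOn_zero_of_preconnected_of_frequently_eq_zero (isPreconnected_strip α) h0 ?_ hθ
  have ht : Filter.Tendsto (fun t : ℝ => (t : ℂ)) (𝓝[≠] 0) (𝓝[≠] (0 : ℂ)) := by
    refine tendsto_nhdsWithin_iff.mpr ⟨?_, ?_⟩
    · exact (Complex.continuous_ofReal.tendsto' 0 0 ofReal_zero).mono_left nhdsWithin_le_nhds
    · filter_upwards [self_mem_nhdsWithin] with t ht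
      exact ofReal_ne_zero.mpr ht
  exact ht.frequently (Filter.Frequently.of_forall h)

/-- Apply the identity theorem to the image of `F` in the normed quotient `E ⧸ S`. -/
theorem mem_of_forall_real {E : Type*} [NormedAddCommGroup E] [NormedSpace ℂ E] (hα : 0 < α)
    {S : Submodule ℂ E} (hS : IsClosed (S : Set E)) {F : ℂ → E}
    (hF : AnalyticOnNhd ℂ F (strip α)) (h : ∀ t : ℝ, F t ∈ S) {θ : ℂ} (hθ : θ ∈ strip α) :
    F θ ∈ S := by
  let q : E →L[ℂ] E ⧸ S :=
    LinearMap.mkContinuous S.mkQ 1 fun L =>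
      (Submodule.Quotient.norm_mk_le S L).trans_eq (one_mul _).symm
  have h1 : AnalyticOnNhd ℂ (fun z => q (F z)) (strip α) := fun z hz => by
    have h := ContinuousLinearMap.analyticAt (𝕜 := ℂ) (E := E) (F := E ⧸ S) q (F z)
    exact h.comp (hF z hz)
  have h2 : q (F θ) = 0 := eq_zero_of_forall_real hα h1
    (fun t => (Submodule.Quotient.mk_eq_zero S).mpr (h t)) hθ
  exact (Submodule.Quotient.mk_eq_zero S).mp h2

theorem isCompactOperator_of_forall_real {X : Type*} [NormedAddCommGroup X] [NormedSpace ℂ X]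
    [CompleteSpace X] (hα : 0 < α) {K : ℂ → X →L[ℂ] X} (hK : AnalyticOnNhd ℂ K (strip α))
    (h : ∀ t : ℝ, IsCompactOperator (K t)) {θ : ℂ} (hθ : θ ∈ strip α) :
    IsCompactOperator (K θ) :=
  mem_of_forall_real (S := compactOperator (RingHom.id ℂ) X X) hα
    isClosed_setOfPred_isCompactOperator hK h hθ

theorem integrableOn_mul_of_bounded {p : ℝ≥0∞} (hp : 1 ≤ p) {S : Set (Rd d)}
    (hS : MeasurableSet S) (hSfin : volume S ≠ ⊤) {f u : Rd d → ℂ} (hf : MemLp f p volume)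
    (hu : AEStronglyMeasurable u volume) {C : ℝ} (hC : ∀ x ∈ S, ‖u x‖ ≤ C) :
    IntegrableOn (fun x => f x * u x) S volume := by
  have : IsFiniteMeasure (volume.restrict S) := ⟨by
    rw [Measure.restrict_apply_univ]
    exact hSfin.lt_top⟩
  refine ((hf.restrict S).integrable hp).mul_bdd (c := C) hu.restrict ?_
  exact (ae_restrict_iff' hS).mpr (Filter.Eventually.of_forall hC)

/-- If operators `K θ` represent the products of an analytic family of `L^p` functions with fixed
square integrable functions for real parameters, they do so on the whole strip. -/
theorem ae_eq_mul_of_forall_real {p : ℝ≥0∞} [Fact (1 ≤ p)] (hα : 0 < α)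
    {W : ℂ → Lp ℂ p (volume : Measure (Rd d))} (hW : AnalyticOnNhd ℂ W (strip α))
    {F : ℂ → L2 d} (hF : AnalyticOnNhd ℂ F (strip α)) (u : L2 d)
    (h : ∀ t : ℝ, F t =ᵐ[volume] fun x => W t x * u x) {θ : ℂ} (hθ : θ ∈ strip α) :
    F θ =ᵐ[volume] fun x => W θ x * u x := by
  -- On subsets of `A n` the function `u` is bounded and the volume finite, so integrating `F θ`, or
  -- `W θ` against `u`, is a continuous functional on `L²`, respectively `L^p`. Both integrals are
  -- therefore analytic in `θ`.
  let A : ℕ → Set (Rd d) := fun n => {x | ‖u x‖ ≤ n} ∩ Metric.ball 0 n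
  have hu := Lp.stronglyMeasurable u
  have hAm : ∀ n, MeasurableSet (A n) := fun n =>
    (measurableSet_le hu.measurable.norm measurable_const).inter measurableSet_ball
  have hAfin : ∀ n, volume (A n) ≠ ⊤ := fun n =>
    ((measure_mono inter_subset_right).trans_lt measure_ball_lt_top).ne
  have hAun : ⋃ n, A n = univ := by
    refine eq_univ_of_forall fun x => ?_
    obtain ⟨n, hn⟩ := exists_nat_gt (max ‖u x‖ ‖x‖)
    exact mem_iUnion.mpr ⟨n, ((le_max_left _ _).trans_lt hn).le,
      mem_ball_zero_iff.mpr ((le_max_right _ _).trans_lt hn)⟩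
  have key : ∀ n, ∀ S, MeasurableSet S → S ⊆ A n →
      ∫ x in S, F θ x = ∫ x in S, W θ x * u x := by
    intro n S hS hSA
    have hSfin : volume S ≠ ⊤ := ((measure_mono hSA).trans_lt (hAfin n).lt_top).ne
    let Λ₁ : L2 d →L[ℂ] ℂ := innerSL ℂ (indicatorConstLp 2 hS hSfin (1 : ℂ))
    have hΛ₁ : ∀ f : L2 d, Λ₁ f = ∫ x in S, f x := fun f =>
      L2.inner_indicatorConstLp_one hS hSfin f
    have hv : MemLp (S.indicator u) (ENNReal.conjExponent p) volume := by
      rw [memLp_indicator_iff_restrict hS]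
      have : IsFiniteMeasure (volume.restrict S) := ⟨by
        rw [Measure.restrict_apply_univ]
        exact hSfin.lt_top⟩
      refine MemLp.of_bound hu.aestronglyMeasurable n ?_
      exact (ae_restrict_iff' hS).mpr (Filter.Eventually.of_forall fun x hx => (hSA hx).1)
    have hq : Fact (1 ≤ ENNReal.conjExponent p) := ⟨le_self_add⟩
    let Λ₂ : Lp ℂ p (volume : Measure (Rd d)) →L[ℂ] ℂ :=
      ((ContinuousLinearMap.mul ℂ ℂ).lpPairing volume p (ENNReal.conjExponent p)).flip hv.toLp
    have hΛ₂ : ∀ f : Lp ℂ p (volume : Measure (Rd d)), Λ₂ f = ∫ x in S, f x * u x := by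
      intro f
      rw [ContinuousLinearMap.flip_apply, ContinuousLinearMap.lpPairing_eq_integral,
        ← integral_indicator hS]
      refine integral_congr_ae ?_
      filter_upwards [hv.coeFn_toLp] with x hx
      rw [hx, ContinuousLinearMap.mul_apply']
      by_cases hxS : x ∈ S <;> simp [hxS]
    have han : AnalyticOnNhd ℂ (fun z => Λ₁ (F z) - Λ₂ (W z)) (strip α) := fun z hz =>
      ((Λ₁.analyticAt _).comp (hF z hz)).sub ((Λ₂.analyticAt _).comp (hW z hz))
    have h0 : Λ₁ (F θ) - Λ₂ (W θ) = 0 := by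
      refine eq_zero_of_forall_real hα han (fun t => ?_) hθ
      rw [hΛ₁, hΛ₂, sub_eq_zero]
      exact integral_congr_ae (ae_restrict_of_ae (h t))
    rw [← hΛ₁, ← hΛ₂]
    exact sub_eq_zero.mp h0
  have hn : ∀ n, F θ =ᵐ[volume.restrict (A n)] fun x => W θ x * u x := by
    intro n
    have hfin : IsFiniteMeasure (volume.restrict (A n)) := ⟨by
      rw [Measure.restrict_apply_univ]
      exact (hAfin n).lt_top⟩
    refine Integrable.ae_eq_of_forall_setIntegral_eq _ _
      (((Lp.memLp (F θ)).restrict (A n)).integrable one_le_two)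
      (integrableOn_mul_of_bounded Fact.out (hAm n) (hAfin n) (Lp.memLp (W θ))
        hu.aestronglyMeasurable fun x hx => hx.1) fun s hs _ => ?_
    rw [Measure.restrict_restrict hs]
    exact key n _ (hs.inter (hAm n)) inter_subset_right
  have hall := (ae_restrict_iUnion_iff A fun x => F θ x = W θ x * u x).mpr hn
  rwa [hAun, Measure.restrict_univ] at hall

end Continuation

/-! ### The dilated operator and the conclusion -/

theorem dilatedOp_freeResolvent {d : ℕ} {θ : ℂ} {Q : Rd d → ℂ} {K : L2 d →L[ℂ] L2 d}
    (hK : IsProdFreeResolvent d (mulOp d Q) K) (f : L2 d) :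
    ∃ h : freeResolvent d f ∈ (dilatedOp d θ Q).domain,
      dilatedOp d θ Q ⟨freeResolvent d f, h⟩ =
        Complex.exp (-2 * θ) • (f - freeResolvent d f) + K f := by
  obtain ⟨h1, h2⟩ := freeOp_freeResolvent d f
  obtain ⟨h3, h4⟩ := isProdFreeResolvent_iff.mp hK f
  refine ⟨⟨h1, h3⟩, ?_⟩
  rw [← h2, ← h4]
  rfl

theorem exists_freeResolvent_eq {d : ℕ} {θ : ℂ} {Q : Rd d → ℂ} {u : L2 d}
    (hu : u ∈ (dilatedOp d θ Q).domain) : ∃ f, freeResolvent d f = u :=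
  ⟨_, freeResolvent_freeOp d ⟨u, hu.1⟩⟩

end DilationAnalytic

theorem proposition2p2 (d : ℕ) (hd : 1 ≤ d) (γ : ℝ) [Fact (1 ≤ γ)] (α : ℝ) (hα : 0 < α)
    (V : DilationAnalytic.Rd d → ℂ) (hV : DilationAnalytic.IsDilationAnalytic γ α V)
    (W : ℂ → MeasureTheory.Lp ℂ (DilationAnalytic.lpExp d γ)
      (MeasureTheory.volume : MeasureTheory.Measure (DilationAnalytic.Rd d)))
    (hW : DilationAnalytic.IsDilationContinuation γ α V W)
    (θ : ℂ) (hθ : θ ∈ DilationAnalytic.strip α) :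
    DilationAnalytic.essentialSpectrum (DilationAnalytic.dilatedOp d θ (W θ)) =
        DilationAnalytic.rotatedHalfLine θ ∧
      DilationAnalytic.spectrumOf (DilationAnalytic.dilatedOp d θ (W θ)) \
          DilationAnalytic.rotatedHalfLine θ =
        DilationAnalytic.discreteSpectrum (DilationAnalytic.dilatedOp d θ (W θ)) := by
  obtain ⟨K₀, hK₀, hK₀c⟩ := hV.compact
  obtain ⟨K, hKan, hK⟩ := hV.resolvent_continuation
  have hcomp : IsCompactOperator (K θ) := DilationAnalytic.isCompactOperator_of_forall_real hα hKan
    (fun t => DilationAnalytic.isCompactOperator_of_dilate hK₀ hK₀c (hK t)) hθ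
  have hprod : DilationAnalytic.IsProdFreeResolvent d (DilationAnalytic.mulOp d (W θ)) (K θ) := by
    rw [DilationAnalytic.isProdFreeResolvent_mulOp_iff]
    intro f
    refine DilationAnalytic.ae_eq_mul_of_forall_real (F := fun z => K z f) hα hW.1
      (fun z hz => ?_) _
      (fun t => ?_) hθ
    · have h := (ContinuousLinearMap.apply ℂ (DilationAnalytic.L2 d) f).analyticAt (K z)
      exact h.comp (hKan z hz)
    filter_upwards [DilationAnalytic.isProdFreeResolvent_mulOp_iff.mp (hK t) f, hW.2 t]
      with x h1 h2
    rw [h1, h2]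
  exact DilationAnalytic.essentialSpectrum_eq_halfLine
    (DilationAnalytic.dilatedOp_freeResolvent hprod)
    (fun _ hu => DilationAnalytic.exists_freeResolvent_eq hu)
    (DilationAnalytic.freeResolvent_injective d) (Complex.exp_ne_zero _)
    (DilationAnalytic.freeResolvent_isPositive d) (DilationAnalytic.norm_freeResolvent_le d) hcomp
    fun t ht0 ht1 => ⟨DilationAnalytic.injective_smul_one_sub_freeResolvent hd t,
      DilationAnalytic.not_isUnit_smul_one_sub_freeResolvent hd ht0 ht1⟩
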